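/- Let $k\ge 1$ be an integer and let $\epsilon>0$ be real. There is a constant $c_0=c_0(k,\epsilon)>0$ such that for every real $c$ with $0<c\le c_0$ there is a constant $C=C(k,\epsilon,c)>0$ with the following property. Let $N\ge 1$ be an integer, let $A\subset\{1,2,\dots,N\}$, and let $\mathcal P$ be a subset of the primes $p\le N^{1/(2k)}$ satisfying \[ \sum_{\substack{p\le N^{1/(2k)},\ p\text{ prime}\\ p\notin\mathcal P}}\frac{\log p}{p}<c\log N. \] Suppose that for each $p\in\mathcal P$ there is an arithmetic progression $S_p\subset\mathbb Z/p\mathbb Z$ of length at most $(1-\epsilon)p$ (that is, $S_p=\{a,a+d,\dots,a+(l-1)d\}$ with $a,d\in\mathbb Z/p\mathbb Z$, $d\ne 0$, and an integer $0\le l\le(1-\epsilon)p$) such that $n \bmod p\in S_p$ for all $n\in A$. Then \[ |A|\le C\,N^{1/2-c}. \] -/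

import Mathlib

/-- `S` is an arithmetic progression of length `l` in the additive group `G`:
`S = {a, a + d, …, a + (l - 1) d}` for some `a` and some nonzero common difference `d`.
(In `ZMod p` with `p` prime and `l ≤ p` the `l` terms are pairwise distinct.) -/
def IsArithProg {G : Type*} [AddCommGroup G] (S : Set G) (l : ℕ) : Prop :=
  ∃ a d : G, d ≠ 0 ∧ S = {x : G | ∃ i : ℕ, i < l ∧ x = a + i • d}

/-- The finite set of primes `p ≤ x`, for a nonnegative real `x`. -/
noncomputable def primesUpTo (x : ℝ) : Finset ℕ :=
  (Finset.Icc 1 ⌊x⌋₊).filter Nat.Prime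

open Finset

/-! Suppose `|A| ≥ N^{1/2-c}`. Confinement to a progression of density at most `1 - ε` modulo `p`
forces a Fourier coefficient of size `≫ |A|` at some `r_p/p` with `p ∤ r_p` (`exists_large_coeff`).
Averaging over primes with weights `w_p = log p / p`, a positive proportion of the differences of
`A` lie in the set `D` of `|n| ≤ N` at which `∑ w_p e(n r_p/p)` is comparable to its trivial bound
(`card_correlated_pairs_ge`).

For primes just below `N^{1/(2K)}`, the `K`-th power of this sum has frequencies with denominators
about `√N` and bounded multiplicity. The dual large sieve then gives `|D| ≤ N^{1/2+O(η)}`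
(`card_large_values_le`), hardly more than `|A|`. So `A` is nearly closed under differences in a
statistical sense, and dependent random choice yields a large `A' ⊆ A` almost all of whose
differences lie in a set `D'` of size `N^{1/2+O(η)}`.

Next comes random sampling (`exists_common_sample`). The normalised coefficients of `A'`, at new
frequencies `ρ_p/p`, are approximated in weighted mean square by averages over `m` sample points,
with `m` bounded. Seen from a point `b` of `A'`, a typical sample is a tuple in `D'^m`. By
pigeonhole one tuple `x` serves for all `b` in a set `T` with `|T| ≥ N^{1/4}`: every translate `x +
b` is a good sample.

Translation by `b` multiplies the sample average by `e(ρ_p b/p)`, so for most `p` these phases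
nearly agree over much of `T`, which puts that part of `T` in a small proportion of the classes
modulo `p`. Gallagher's larger sieve forbids this (`larger_sieve_of_common_phases`). -/

/-! ### Additive characters and geometric sums. -/

/-- The additive character `t ↦ exp (2πit)` of the real line. -/
noncomputable def ee (t : ℝ) : ℂ := Complex.exp ((2 * Real.pi * t : ℝ) * Complex.I)

lemma ee_add (s t : ℝ) : ee (s + t) = ee s * ee t := by
  unfold ee
  rw [← Complex.exp_add]
  congr 1
  push_cast
  ring

lemma norm_ee (t : ℝ) : ‖ee t‖ = 1 := Complex.norm_exp_ofReal_mul_I _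

lemma ee_int (n : ℤ) : ee n = 1 := by
  unfold ee
  rw [Complex.exp_eq_one_iff]
  exact ⟨n, by push_cast; ring⟩

lemma ee_zero : ee 0 = 1 := by simpa using ee_int 0

lemma ee_add_int (t : ℝ) (n : ℤ) : ee (t + n) = ee t := by
  rw [ee_add, ee_int, mul_one]

lemma conj_ee (t : ℝ) : (starRingEnd ℂ) (ee t) = ee (-t) := by
  unfold ee
  rw [← Complex.exp_conj]
  congr 1
  rw [map_mul, Complex.conj_ofReal, Complex.conj_I]
  push_cast
  ring

lemma ee_sum {ι : Type*} (s : Finset ι) (f : ι → ℝ) : ee (∑ i ∈ s, f i) = ∏ i ∈ s, ee (f i) := by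
  classical
  induction s using Finset.induction_on with
  | empty => simp [ee_zero]
  | insert a s ha ih => rw [sum_insert ha, prod_insert ha, ee_add, ih]

lemma ee_nat_mul (n : ℕ) (t : ℝ) : ee (n * t) = ee t ^ n := by
  unfold ee
  rw [← Complex.exp_nat_mul]
  congr 1
  push_cast
  ring

lemma norm_ee_sub_one (t : ℝ) : ‖ee t - 1‖ = 2 * |Real.sin (Real.pi * t)| := by
  unfold ee
  rw [mul_comm, Complex.norm_exp_I_mul_ofReal_sub_one, Real.norm_eq_abs, abs_mul, abs_two]
  congr 3
  ring

lemma four_mul_min_le_norm_ee_sub_one {t : ℝ} (h0 : 0 ≤ t) (h1 : t ≤ 1) :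
    4 * min t (1 - t) ≤ ‖ee t - 1‖ := by
  have key : ∀ s : ℝ, 0 ≤ s → s ≤ 1 / 2 → 2 * s ≤ Real.sin (Real.pi * s) := by
    intro s hs hs'
    have := Real.mul_le_sin (x := Real.pi * s) (by positivity)
      (by nlinarith [Real.pi_pos])
    calc 2 * s = 2 / Real.pi * (Real.pi * s) := by field_simp
      _ ≤ _ := this
  rw [norm_ee_sub_one]
  rcases le_total t (1 / 2) with h | h
  · have := key t h0 h
    have h2 := le_abs_self (Real.sin (Real.pi * t))
    have h3 := min_le_left t (1 - t)
    linarith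
  · have := key (1 - t) (by linarith) (by linarith)
    rw [show Real.pi * (1 - t) = Real.pi - Real.pi * t by ring, Real.sin_pi_sub] at this
    have h2 := le_abs_self (Real.sin (Real.pi * t))
    have h3 := min_le_right t (1 - t)
    linarith

/-- A nonzero distance of `ee t` from `1` bounds the geometric sums with ratio `ee t`. -/
lemma norm_sum_range_ee_mul_le (t : ℝ) (J : ℕ) :
    ‖∑ j ∈ range J, ee (j * t)‖ * ‖ee t - 1‖ ≤ 2 := by
  have : ∑ j ∈ range J, ee (j * t) = ∑ j ∈ range J, ee t ^ j :=
    sum_congr rfl fun j _ => ee_nat_mul j t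
  rw [this, ← norm_mul, geom_sum_mul]
  calc ‖ee t ^ J - 1‖ ≤ ‖ee t ^ J‖ + ‖(1 : ℂ)‖ := norm_sub_le _ _
    _ = 2 := by rw [norm_pow, norm_ee]; norm_num

lemma norm_sum_range_ee_le {t δ : ℝ} (hδ : 0 < δ) (h0 : δ ≤ t) (h1 : t ≤ 1 - δ) (J : ℕ) :
    ‖∑ j ∈ range J, ee (j * t)‖ ≤ 1 / (2 * δ) := by
  have h := norm_sum_range_ee_mul_le t J
  have h2 := four_mul_min_le_norm_ee_sub_one (t := t) (by linarith) (by linarith)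
  have h3 : δ ≤ min t (1 - t) := le_min h0 (by linarith)
  rw [le_div_iff₀ (by positivity)]
  have : ‖∑ j ∈ range J, ee (j * t)‖ * (4 * δ) ≤ 2 :=
    le_trans (mul_le_mul_of_nonneg_left (by linarith) (norm_nonneg _)) h
  linarith

lemma sq_norm_sum_ee {ι : Type*} (s : Finset ι) (f : ι → ℝ) :
    ((‖∑ j ∈ s, ee (f j)‖ ^ 2 : ℝ) : ℂ) = ∑ j ∈ s, ∑ j' ∈ s, ee (f j - f j') := by
  rw [Complex.ofReal_pow, ← Complex.mul_conj', map_sum, sum_mul_sum]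
  refine sum_congr rfl fun i _ => sum_congr rfl fun j _ => ?_
  rw [conj_ee, ← ee_add, sub_eq_add_neg]

/-! ### Fourier bias of sets that miss an interval. -/

/-- If all `u x` stay at distance `≥ δ` from the integers, some low frequency is biased. -/
lemma exists_frequency_of_avoids_zero {ι : Type*} (A : Finset ι) (u : ι → ℝ) {δ : ℝ} (hδ : 0 < δ)
    (hu : ∀ x ∈ A, δ ≤ u x ∧ u x ≤ 1 - δ) (hA : A.Nonempty) {J : ℕ} (hJ : 1 ≤ 2 * δ ^ 2 * J) :
    ∃ h : ℤ, h ≠ 0 ∧ |h| < J ∧ (A.card : ℝ) / (2 * J) ≤ ‖∑ x ∈ A, ee (h * u x)‖ := by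
  have hJ0 : 0 < (J : ℝ) := by
    rcases Nat.eq_zero_or_pos J with h | h
    · subst h; norm_num at hJ
    · exact_mod_cast h
  have hc : (0 : ℝ) < A.card := by exact_mod_cast hA.card_pos
  by_contra hcon
  push Not at hcon
  -- Second moment of the geometric sums: expanded, the diagonal alone gives `J|A|`, while staying
  -- away from the integers caps the total at `J|A|/2`. The off-diagonal frequencies `j - j'` must
  -- account for the gap.
  have h1 : ∀ x ∈ A, ‖∑ j ∈ range J, ee (j * u x)‖ ^ 2 ≤ J / 2 := by
    intro x hx
    have := norm_sum_range_ee_le hδ (hu x hx).1 (hu x hx).2 J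
    calc _ ≤ (1 / (2 * δ)) ^ 2 := by gcongr
      _ ≤ J / 2 := by
        rw [div_pow, div_le_div_iff₀ (by positivity) (by positivity)]
        nlinarith
  have h2 : ∑ x ∈ A, ‖∑ j ∈ range J, ee (j * u x)‖ ^ 2 ≤ A.card * (J / 2) := by
    rw [← nsmul_eq_mul]
    exact sum_le_card_nsmul _ _ _ h1
  have h3 : ((∑ x ∈ A, ‖∑ j ∈ range J, ee (j * u x)‖ ^ 2 : ℝ) : ℂ)
      = ∑ j ∈ range J, ∑ j' ∈ range J, ∑ x ∈ A, ee (((j : ℤ) - (j' : ℤ) : ℤ) * u x) := by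
    rw [Complex.ofReal_sum]
    simp_rw [sq_norm_sum_ee]
    rw [sum_comm]
    refine sum_congr rfl fun j _ => ?_
    rw [sum_comm]
    refine sum_congr rfl fun j' _ => sum_congr rfl fun x _ => ?_
    congr 1
    push_cast
    ring
  have h4 : ∀ j ∈ range J, ∀ j' ∈ range J,
      ‖(∑ x ∈ A, ee (((j : ℤ) - (j' : ℤ) : ℤ) * u x)) - (if j = j' then (A.card : ℂ) else 0)‖
        ≤ if j = j' then 0 else (A.card : ℝ) / (2 * J) := by
    intro j hj j' hj'
    by_cases e : j = j'
    · subst e; simp [ee_zero]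
    · simp only [e, if_false, sub_zero]
      refine (hcon _ (by omega) ?_).le
      rw [mem_range] at hj hj'
      rw [abs_lt]; omega
  have h5 : ‖((∑ x ∈ A, ‖∑ j ∈ range J, ee (j * u x)‖ ^ 2 : ℝ) : ℂ) - (J * A.card : ℂ)‖
      ≤ ∑ j ∈ range J, ∑ j' ∈ range J, if j = j' then 0 else (A.card : ℝ) / (2 * J) := by
    have : (J * A.card : ℂ) = ∑ j ∈ range J, ∑ j' ∈ range J, if j = j' then (A.card : ℂ) else 0 := by
      rw [sum_congr rfl fun j hj => by rw [sum_ite_eq, if_pos hj]]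
      simp
    rw [h3, this, ← sum_sub_distrib]
    refine (norm_sum_le _ _).trans (sum_le_sum fun j hj => ?_)
    rw [← sum_sub_distrib]
    exact (norm_sum_le _ _).trans (sum_le_sum fun j' hj' => h4 j hj j' hj')
  -- Strict because the diagonal terms are absent; the contradiction needs this strictness.
  have h6 : ∑ j ∈ range J, ∑ j' ∈ range J, (if j = j' then (0:ℝ) else (A.card : ℝ) / (2 * J))
      < J * A.card / 2 := by
    have : ∑ j ∈ range J, ∑ j' ∈ range J, (if j = j' then (0:ℝ) else (A.card : ℝ) / (2 * J))
        < ∑ j ∈ range J, ∑ j' ∈ range J, (A.card : ℝ) / (2 * J) := by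
      refine sum_lt_sum_of_nonempty ⟨0, by simpa using Nat.cast_pos.1 hJ0⟩ fun j hj => ?_
      refine sum_lt_sum (fun j' _ => ?_) ⟨j, hj, ?_⟩
      · split_ifs <;> [positivity; rfl]
      · simp only [if_true]; positivity
    refine this.trans_eq ?_
    simp only [sum_const, card_range, nsmul_eq_mul]
    field_simp
  rw [show (J * A.card : ℂ) = ((J * A.card : ℝ) : ℂ) by push_cast; rfl, ← Complex.ofReal_sub,
    Complex.norm_real, Real.norm_eq_abs] at h5
  have h7 := neg_abs_le (∑ x ∈ A, ‖∑ j ∈ range J, ee (j * u x)‖ ^ 2 - J * A.card)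
  linarith

/-- The Fourier bias of sets contained in a progression of density `≤ 1 - ε` modulo `p`. -/
lemma exists_large_coeff {ε : ℝ} (hε : 0 < ε) {J : ℕ} (hJ : 2 ≤ ε ^ 2 * J) {p : ℕ}
    (hp : p.Prime) (hJp : J ≤ p) {S : Set (ZMod p)} {l : ℕ} (hS : IsArithProg S l)
    (hl : (l : ℝ) ≤ (1 - ε) * p) (A : Finset ℤ) (hA : A.Nonempty) (hAS : ∀ a ∈ A, (a : ZMod p) ∈ S) :
    ∃ r : ℤ, ¬ (p : ℤ) ∣ r ∧ (A.card : ℝ) / (2 * J) ≤ ‖∑ a ∈ A, ee (r * a / p)‖ := by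
  have := Fact.mk hp
  obtain ⟨a₀, d, hd, rfl⟩ := hS
  simp only [Set.mem_ofPred_eq] at hAS
  have hp0 : (0 : ℝ) < p := by exact_mod_cast hp.pos
  choose! i hi hai using hAS
  obtain ⟨r₀, hr₀⟩ := ZMod.intCast_surjective d⁻¹
  obtain ⟨s, hs⟩ := ZMod.intCast_surjective (d⁻¹ * a₀)
  have hmod : ∀ a ∈ A, ∃ z : ℤ, r₀ * a = s + i a + p * z := by
    intro a ha
    have : ((r₀ * a - (s + i a) : ℤ) : ZMod p) = 0 := by
      push_cast
      rw [hr₀, hs, hai a ha, nsmul_eq_mul]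
      field_simp
      ring
    rw [ZMod.intCast_zmod_eq_zero_iff_dvd] at this
    obtain ⟨z, hz⟩ := this
    exact ⟨z, by linarith⟩
  -- Dividing by `d` turns the progression into the interval `0, …, l - 1`; `c` is the midpoint of
  -- the complementary gap from `l - 1` to `p`, so `(c - i)/p` is at least `ε/2` from every integer.
  set c : ℝ := ((l : ℝ) - 1 + p) / 2 with hc
  obtain ⟨h, h0, hhJ, hh⟩ := exists_frequency_of_avoids_zero A (fun a => (c - i a) / p) (δ := ε / 2)
    (by positivity) (by
      intro a ha
      have h1 : (i a : ℝ) + 1 ≤ l := by exact_mod_cast hi a ha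
      have h2 : (0 : ℝ) ≤ i a := Nat.cast_nonneg _
      rw [le_div_iff₀ hp0, div_le_iff₀ hp0]
      constructor <;> nlinarith) hA (J := J) (by nlinarith)
  refine ⟨-h * r₀, ?_, ?_⟩
  · intro hdvd
    rcases (Nat.prime_iff_prime_int.1 hp).dvd_or_dvd hdvd with h1 | h1
    · rw [dvd_neg] at h1
      have := Int.le_of_dvd (abs_pos.2 h0) ((dvd_abs _ _).2 h1)
      have : (J : ℤ) ≤ p := by exact_mod_cast hJp
      omega
    · rw [← ZMod.intCast_zmod_eq_zero_iff_dvd, hr₀] at h1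
      exact hd (inv_eq_zero.1 h1)
  · refine hh.trans_eq ?_
    have : ∀ a ∈ A, ee (((-h * r₀ : ℤ) : ℝ) * a / p) = ee (-h * (s + c) / p) * ee (h * ((c - i a) / p)) := by
      intro a ha
      obtain ⟨z, hz⟩ := hmod a ha
      have hz' : (r₀ : ℝ) * a = s + i a + p * z := by exact_mod_cast hz
      rw [← ee_add, ← ee_add_int _ (h * z)]
      congr 1
      push_cast
      field_simp
      rw [hz']
      ring
    rw [sum_congr rfl this, ← mul_sum, norm_mul, norm_ee, one_mul]

/-! ### The Dirichlet kernel and the dual large sieve. -/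

/-- The Dirichlet kernel `∑_{|n| ≤ N} ee (nβ)`. -/
noncomputable def dirichletKernel (N : ℕ) (β : ℝ) : ℂ := ∑ n ∈ Icc (-(N : ℤ)) N, ee (n * β)

lemma sum_Icc_neg_eq_sum_range {M : Type*} [AddCommMonoid M] (N : ℕ) (f : ℤ → M) :
    ∑ n ∈ Icc (-(N : ℤ)) N, f n = ∑ j ∈ range (2 * N + 1), f ((j : ℤ) - N) := by
  refine sum_nbij' (fun n => (n + N).toNat) (fun j => (j : ℤ) - N) ?_ ?_ ?_ ?_ ?_
  · intro n hn; rw [mem_Icc] at hn; rw [mem_range]; omega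
  · intro j hj; rw [mem_range] at hj; rw [mem_Icc]; omega
  · intro n hn; rw [mem_Icc] at hn; omega
  · intro j hj; simp
  · intro n hn; rw [mem_Icc] at hn; congr 1; omega

lemma norm_dirichletKernel_eq (N : ℕ) (β : ℝ) :
    ‖dirichletKernel N β‖ = ‖∑ j ∈ range (2 * N + 1), ee (j * β)‖ := by
  unfold dirichletKernel
  rw [sum_Icc_neg_eq_sum_range]
  have : ∀ j ∈ range (2 * N + 1), ee ((((j : ℤ) - N : ℤ) : ℝ) * β) = ee (-N * β) * ee (j * β) := by
    intro j _
    rw [← ee_add]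
    congr 1
    push_cast
    ring
  rw [sum_congr rfl this, ← mul_sum, norm_mul, norm_ee, one_mul]

lemma norm_dirichletKernel_le (N : ℕ) (β : ℝ) : ‖dirichletKernel N β‖ ≤ 2 * N + 1 := by
  unfold dirichletKernel
  refine (norm_sum_le _ _).trans ?_
  simp only [norm_ee, sum_const, Int.card_Icc, nsmul_eq_mul, mul_one]
  have : ((N : ℤ) + 1 - -(N : ℤ)).toNat = 2 * N + 1 := by omega
  rw [this]
  push_cast
  rfl

lemma norm_dirichletKernel_neg (N : ℕ) (β : ℝ) :
    ‖dirichletKernel N (-β)‖ = ‖dirichletKernel N β‖ := by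
  rw [← Complex.norm_conj (dirichletKernel N β)]
  unfold dirichletKernel
  rw [map_sum]
  congr 1
  refine sum_congr rfl fun n _ => ?_
  rw [conj_ee]
  congr 1
  ring

lemma dirichletKernel_fract (N : ℕ) (β : ℝ) :
    dirichletKernel N (Int.fract β) = dirichletKernel N β := by
  unfold dirichletKernel
  refine sum_congr rfl fun n _ => ?_
  rw [← ee_add_int _ (n * ⌊β⌋)]
  congr 1
  have := Int.fract_add_floor β
  push_cast
  rw [← mul_add, this]

/-- Binning `β` modulo 1 into arcs of length `1/N` makes the kernel bound depend only on the bin,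
with a harmonic total. The extreme bins, which touch the integers, use the trivial bound. -/
lemma norm_dirichletKernel_le_of_floor {N k : ℕ} (hN : 1 ≤ N) (hk : k < N) {β : ℝ}
    (h0 : (k : ℝ) ≤ N * Int.fract β) (h1 : N * Int.fract β < k + 1) :
    ‖dirichletKernel N β‖ ≤ 3 * N * (1 / ((k : ℝ) + 1) + 1 / ((N : ℝ) - k)) := by
  have hN' : (1 : ℝ) ≤ N := by exact_mod_cast hN
  have hkN : (k : ℝ) + 1 ≤ N := by exact_mod_cast hk
  have htriv : ‖dirichletKernel N β‖ ≤ 3 * N := (norm_dirichletKernel_le N β).trans (by linarith)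
  have hk0 : (0 : ℝ) ≤ k := Nat.cast_nonneg k
  have ha : 0 ≤ 1 / ((k : ℝ) + 1) := by positivity
  have hb : 0 ≤ 1 / ((N : ℝ) - k) := by
    apply div_nonneg zero_le_one; linarith
  rcases Nat.eq_zero_or_pos k with rfl | hkpos
  · refine htriv.trans (le_mul_of_one_le_right (by positivity) ?_)
    norm_num at hb ⊢
  by_cases hkN1 : k + 1 = N
  · refine htriv.trans (le_mul_of_one_le_right (by positivity) ?_)
    have : (N : ℝ) - k = 1 := by rw [← hkN1]; push_cast; ring
    rw [this]; linarith
  have hk1 : (1 : ℝ) ≤ k := by exact_mod_cast hkpos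
  have hkN2 : (k : ℝ) + 2 ≤ N := by
    have : k + 2 ≤ N := by omega
    exact_mod_cast this
  rw [← dirichletKernel_fract, norm_dirichletKernel_eq]
  set x := Int.fract β
  have hx0 : (k : ℝ) / N ≤ x := by rw [div_le_iff₀ (by linarith)]; linarith
  have hx1 : x ≤ 1 - ((N : ℝ) - k - 1) / N := by
    rw [le_sub_iff_add_le, ← le_sub_iff_add_le', div_le_iff₀ (by linarith)]
    nlinarith
  have hmin : (0 : ℝ) < min (k : ℝ) (N - k - 1) := lt_min (by linarith) (by linarith)
  refine (norm_sum_range_ee_le (δ := min (k : ℝ) (N - k - 1) / N) (by positivity) ?_ ?_ _).trans ?_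
  · exact le_trans (by gcongr; exact min_le_left _ _) hx0
  · refine hx1.trans (sub_le_sub_left ?_ 1)
    gcongr
    exact min_le_right _ _
  · have e : 1 / (2 * (min (k : ℝ) (N - k - 1) / N)) = N / 2 * (1 / min (k : ℝ) (N - k - 1)) := by
      field_simp
    rw [e]
    have h2 : 1 / min (k : ℝ) (N - k - 1) ≤ 2 * (1 / ((k : ℝ) + 1) + 1 / ((N : ℝ) - k)) := by
      rcases min_choice (k : ℝ) (N - k - 1) with h | h <;> rw [h]
      · have : 1 / (k : ℝ) ≤ 2 * (1 / ((k : ℝ) + 1)) := by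
          rw [mul_one_div, div_le_div_iff₀ (by linarith) (by linarith)]; linarith
        linarith
      · have : 1 / ((N : ℝ) - k - 1) ≤ 2 * (1 / ((N : ℝ) - k)) := by
          rw [mul_one_div, div_le_div_iff₀ (by linarith) (by linarith)]; linarith
        linarith
    calc (N : ℝ) / 2 * (1 / min (k : ℝ) (N - k - 1))
        ≤ N / 2 * (2 * (1 / ((k : ℝ) + 1) + 1 / ((N : ℝ) - k))) := by gcongr
      _ ≤ 3 * N * (1 / ((k : ℝ) + 1) + 1 / ((N : ℝ) - k)) := by
        nlinarith [mul_nonneg (show (0 : ℝ) ≤ N by linarith) (add_nonneg ha hb)]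

lemma sum_range_inv_add_inv_le (N : ℕ) :
    ∑ k ∈ range N, 3 * N * (1 / ((k : ℝ) + 1) + 1 / ((N : ℝ) - k)) ≤ 6 * N * (1 + Real.log N) := by
  have h1 : ∑ k ∈ range N, 1 / ((k : ℝ) + 1) ≤ 1 + Real.log N := by
    have := harmonic_le_one_add_log N
    unfold harmonic at this
    push_cast at this
    simpa [one_div] using this
  have h2 : ∑ k ∈ range N, 1 / ((N : ℝ) - k) = ∑ k ∈ range N, 1 / ((k : ℝ) + 1) := by
    rw [← sum_range_reflect]
    refine sum_congr rfl fun k hk => ?_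
    rw [mem_range] at hk
    rw [Nat.cast_sub (by omega), Nat.cast_sub (by omega)]
    congr 1
    push_cast
    ring
  rw [← mul_sum, sum_add_distrib, h2]
  nlinarith [mul_nonneg (Nat.cast_nonneg (α := ℝ) N) (sub_nonneg.2 h1)]

/-- The dual large sieve inequality with a logarithmic loss, for points with rational differences. -/
lemma dual_large_sieve {ι : Type*} [Fintype ι] {N : ℕ} (hN : 1 ≤ N) (α : ι → ℝ) (c : ι → ℝ)
    (B : ℕ) (hsep : ∀ s t, ∃ Q : ℕ, 1 ≤ Q ∧ Q ≤ N ∧ ∃ a : ℤ, (α s - α t) * Q = a)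
    (hB : ∀ s, ∀ T : Finset ι, (∀ t ∈ T, ∃ z : ℤ, α t - α s = z) → T.card ≤ B) :
    ∑ n ∈ Icc (-(N : ℤ)) N, ‖∑ t, (c t : ℂ) * ee (n * α t)‖ ^ 2
      ≤ 6 * N * (1 + Real.log N) * B * ∑ t, c t ^ 2 := by
  classical
  have hNpos : (0 : ℝ) < N := by exact_mod_cast hN
  -- Schur's test: it suffices to bound the row sums of the Gram matrix.
  have hrow : ∀ s, ∑ t, ‖dirichletKernel N (α t - α s)‖ ≤ 6 * N * (1 + Real.log N) * B := by
    intro s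
    set k : ι → ℕ := fun t => ⌊N * Int.fract (α t - α s)⌋₊ with hk
    have hknn : ∀ t, 0 ≤ N * Int.fract (α t - α s) := fun t =>
      mul_nonneg hNpos.le (Int.fract_nonneg _)
    have hklt : ∀ t, k t < N := by
      intro t
      rw [hk, Nat.floor_lt (hknn t)]
      exact mul_lt_of_lt_one_right hNpos (Int.fract_lt_one _)
    -- Two points in one bin differ modulo 1 by less than `1/N`, and by a rational of denominator at
    -- most `N`; hence they coincide modulo 1.
    have hfib : ∀ i, (univ.filter fun t => k t = i).card ≤ B := by
      intro i
      rcases (univ.filter fun t => k t = i).eq_empty_or_nonempty with h | ⟨t₀, ht₀⟩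
      · rw [h]; simp
      refine hB t₀ _ fun t ht => ?_
      simp only [mem_filter, mem_univ, true_and] at ht ht₀
      obtain ⟨Q, hQ1, hQN, a, ha⟩ := hsep t t₀
      have hQ0 : (0 : ℝ) < Q := by exact_mod_cast hQ1
      have hQN' : (Q : ℝ) ≤ N := by exact_mod_cast hQN
      have e1 := Nat.floor_le (hknn t)
      have e2 := Nat.lt_floor_add_one (N * Int.fract (α t - α s))
      have e3 := Nat.floor_le (hknn t₀)
      have e4 := Nat.lt_floor_add_one (N * Int.fract (α t₀ - α s))
      change ⌊N * Int.fract (α t - α s)⌋₊ = i at ht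
      change ⌊N * Int.fract (α t₀ - α s)⌋₊ = i at ht₀
      rw [ht] at e1 e2
      rw [ht₀] at e3 e4
      set z : ℤ := ⌊α t - α s⌋ - ⌊α t₀ - α s⌋ with hz
      have hd : α t - α t₀ = z + (Int.fract (α t - α s) - Int.fract (α t₀ - α s)) := by
        rw [hz, Int.fract, Int.fract]; push_cast; ring
      set δ := Int.fract (α t - α s) - Int.fract (α t₀ - α s) with hδ
      have hδN : |N * δ| < 1 := by
        rw [hδ, mul_sub, abs_lt]; constructor <;> linarith
      have hδQ : δ * Q = ((a - z * Q : ℤ) : ℝ) := by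
        push_cast; rw [← ha, hd]; ring
      have hlt : |((a - z * Q : ℤ) : ℝ)| < 1 := by
        rw [← hδQ, abs_mul, abs_of_pos hQ0]
        rw [abs_mul, abs_of_pos hNpos] at hδN
        nlinarith [abs_nonneg δ]
      have hzero : a - z * Q = 0 := by
        rw [← Int.abs_lt_one_iff]
        exact_mod_cast hlt
      rw [hzero] at hδQ
      have hδ0 : δ = 0 := by
        rcases mul_eq_zero.1 (hδQ.trans Int.cast_zero) with h | h
        · exact h
        · exact absurd h hQ0.ne'
      exact ⟨z, by rw [hd, hδ0, add_zero]⟩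
    set F : ℕ → ℝ := fun k => 3 * N * (1 / ((k : ℝ) + 1) + 1 / ((N : ℝ) - k)) with hF
    have hFnn : ∀ i ∈ range N, 0 ≤ F i := by
      intro i hi
      have : (i : ℝ) < N := by exact_mod_cast mem_range.1 hi
      have : 0 ≤ 1 / ((N : ℝ) - i) := div_nonneg zero_le_one (by linarith)
      rw [hF]; positivity
    calc ∑ t, ‖dirichletKernel N (α t - α s)‖ ≤ ∑ t, F (k t) := by
          refine sum_le_sum fun t _ => norm_dirichletKernel_le_of_floor hN (hklt t) ?_ ?_
          · exact Nat.floor_le (hknn t)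
          · exact Nat.lt_floor_add_one _
      _ = ∑ i ∈ range N, ∑ t ∈ univ.filter (fun t => k t = i), F (k t) :=
          (sum_fiberwise_of_maps_to (fun t _ => mem_range.2 (hklt t)) _).symm
      _ ≤ ∑ i ∈ range N, B * F i := by
          refine sum_le_sum fun i hi => ?_
          rw [sum_congr rfl (g := fun _ => F i) (by
            intro t ht; rw [(mem_filter.1 ht).2]), sum_const, nsmul_eq_mul]
          exact mul_le_mul_of_nonneg_right (by exact_mod_cast hfib i) (hFnn i hi)
      _ ≤ 6 * N * (1 + Real.log N) * B := by
          rw [← mul_sum, mul_comm]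
          exact mul_le_mul_of_nonneg_right (sum_range_inv_add_inv_le N) (Nat.cast_nonneg _)
  have hexp : ((∑ n ∈ Icc (-(N : ℤ)) N, ‖∑ t, (c t : ℂ) * ee (n * α t)‖ ^ 2 : ℝ) : ℂ)
      = ∑ s, ∑ t, (c s * c t : ℂ) * dirichletKernel N (α s - α t) := by
    unfold dirichletKernel
    simp_rw [mul_sum]
    rw [Complex.ofReal_sum, sum_congr rfl fun s _ => sum_comm, sum_comm]
    refine sum_congr rfl fun n _ => ?_
    rw [Complex.ofReal_pow, ← Complex.mul_conj', map_sum, sum_mul_sum]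
    refine sum_congr rfl fun s _ => sum_congr rfl fun t _ => ?_
    rw [map_mul, Complex.conj_ofReal, conj_ee, mul_sub, sub_eq_add_neg, ee_add]
    ring
  have h1 : ∑ n ∈ Icc (-(N : ℤ)) N, ‖∑ t, (c t : ℂ) * ee (n * α t)‖ ^ 2
      ≤ ∑ s, ∑ t, (c s ^ 2 / 2 + c t ^ 2 / 2) * ‖dirichletKernel N (α s - α t)‖ := by
    rw [← Real.norm_of_nonneg (show 0 ≤ ∑ n ∈ Icc (-(N : ℤ)) N, ‖∑ t, (c t : ℂ) * ee (n * α t)‖ ^ 2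
      from sum_nonneg fun _ _ => by positivity), ← Complex.norm_real, hexp]
    refine (norm_sum_le _ _).trans (sum_le_sum fun s _ => ?_)
    refine (norm_sum_le _ _).trans (sum_le_sum fun t _ => ?_)
    rw [norm_mul, ← Complex.ofReal_mul, Complex.norm_real, Real.norm_eq_abs]
    refine mul_le_mul_of_nonneg_right ?_ (norm_nonneg _)
    rw [abs_le]
    constructor <;> nlinarith [sq_nonneg (c s - c t), sq_nonneg (c s + c t)]
  have h2 : ∑ s, ∑ t, (c s ^ 2 / 2 + c t ^ 2 / 2) * ‖dirichletKernel N (α s - α t)‖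
      = ∑ s, c s ^ 2 * ∑ t, ‖dirichletKernel N (α t - α s)‖ := by
    simp_rw [add_mul, sum_add_distrib, mul_sum]
    rw [sum_comm (f := fun s t => c t ^ 2 / 2 * ‖dirichletKernel N (α s - α t)‖),
      ← sum_add_distrib]
    refine sum_congr rfl fun s _ => ?_
    rw [← sum_add_distrib]
    refine sum_congr rfl fun t _ => ?_
    rw [← norm_dirichletKernel_neg N (α s - α t), neg_sub]
    ring
  calc _ ≤ _ := h1
    _ = _ := h2
    _ ≤ ∑ s, c s ^ 2 * (6 * N * (1 + Real.log N) * B) :=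
        sum_le_sum fun s _ => mul_le_mul_of_nonneg_left (hrow s) (sq_nonneg _)
    _ = _ := by rw [← sum_mul]; ring

/-! ### Sums of fractions with prime denominators, and large values by high moments. -/

lemma exists_int_sum_div_mul_prod {ι : Type*} (s : Finset ι) (r : ι → ℤ) (p : ι → ℕ)
    (hp : ∀ i ∈ s, p i ≠ 0) :
    ∃ a : ℤ, (∑ i ∈ s, (r i : ℝ) / p i) * ∏ i ∈ s, (p i : ℝ) = a := by
  classical
  refine ⟨∑ i ∈ s, r i * ∏ j ∈ s.erase i, (p j : ℤ), ?_⟩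
  push_cast
  rw [sum_mul]
  refine sum_congr rfl fun i hi => ?_
  rw [← mul_prod_erase s _ hi]
  have : (p i : ℝ) ≠ 0 := by exact_mod_cast hp i hi
  field_simp

/-- Uniqueness of partial fractions modulo 1: if `q` occurs among the `t i` but not among the `t'
j`, the terms with denominator `q` add to `e·r/q`, where `e` is the multiplicity, and nothing else
cancels this `q`. The bound on `Fintype.card ι` ensures `q ∤ e`. -/
lemma prime_mem_range_of_sum_sub_sum_int {ι κ : Type*} [Fintype ι] [Fintype κ] (t : ι → ℕ)
    (t' : κ → ℕ) (r : ℕ → ℤ) (ht : ∀ i, (t i).Prime) (ht' : ∀ i, (t' i).Prime)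
    (hr : ∀ i, ¬ (t i : ℤ) ∣ r (t i)) (hcard : ∀ i, Fintype.card ι < t i) {z : ℤ}
    (hz : (∑ i, (r (t i) : ℝ) / t i) - ∑ i, (r (t' i) : ℝ) / t' i = z) (i₀ : ι) :
    ∃ j, t' j = t i₀ := by
  classical
  by_contra! hcon
  set q := t i₀ with hq
  set s : Finset ι := univ.filter fun i => t i ≠ q with hs
  set e : Finset ι := univ.filter fun i => t i = q with he
  obtain ⟨a₁, ha₁⟩ := exists_int_sum_div_mul_prod s (fun i => r (t i)) t fun i _ => (ht i).ne_zero
  obtain ⟨a₂, ha₂⟩ := exists_int_sum_div_mul_prod univ (fun i => r (t' i)) t'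
    fun i _ => (ht' i).ne_zero
  have hsplit : ∑ i, (r (t i) : ℝ) / t i = e.card * ((r q : ℝ) / q) + ∑ i ∈ s, (r (t i) : ℝ) / t i := by
    rw [← sum_filter_add_sum_filter_not univ (fun i => t i = q)]
    congr 1
    rw [sum_congr rfl (g := fun _ => (r q : ℝ) / q) fun i hi => by rw [(mem_filter.1 hi).2],
      sum_const, nsmul_eq_mul]
  have hq0 : (q : ℝ) ≠ 0 := by exact_mod_cast (ht i₀).ne_zero
  -- Clear all denominators: `q` divides the right side but none of the factors on the left.
  have hmain : ((e.card : ℤ) * r q * ((∏ i ∈ s, (t i : ℤ)) * ∏ j, (t' j : ℤ)) : ℤ)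
      = q * (z * ((∏ i ∈ s, (t i : ℤ)) * ∏ j, (t' j : ℤ)) - a₁ * ∏ j, (t' j : ℤ)
        + a₂ * ∏ i ∈ s, (t i : ℤ)) := by
    have : ((e.card : ℝ) * r q * ((∏ i ∈ s, (t i : ℝ)) * ∏ j, (t' j : ℝ)))
      = q * (z * ((∏ i ∈ s, (t i : ℝ)) * ∏ j, (t' j : ℝ)) - a₁ * ∏ j, (t' j : ℝ)
        + a₂ * ∏ i ∈ s, (t i : ℝ)) := by
      rw [← ha₁, ← ha₂, ← hz, hsplit]
      field_simp
      ring
    exact_mod_cast this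
  have hprime := Nat.prime_iff_prime_int.1 (ht i₀)
  have hdvd : (q : ℤ) ∣ (e.card : ℤ) * r q * ((∏ i ∈ s, (t i : ℤ)) * ∏ j, (t' j : ℤ)) :=
    ⟨_, hmain⟩
  have hne : ∀ p : ℕ, p.Prime → p ≠ q → ¬ (q : ℤ) ∣ p := by
    intro p hp hpq hd
    exact hpq ((Nat.prime_dvd_prime_iff_eq (ht i₀) hp).1 (Int.natCast_dvd_natCast.1 hd)).symm
  rcases hprime.dvd_or_dvd hdvd with h | h
  · rcases hprime.dvd_or_dvd h with h | h
    · have h1 : 0 < e.card := card_pos.2 ⟨i₀, by simp [he, hq]⟩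
      have h2 : e.card ≤ Fintype.card ι := card_le_univ e
      have h3 := Nat.le_of_dvd h1 (Int.natCast_dvd_natCast.1 h)
      have h4 := hcard i₀
      omega
    · exact hr i₀ h
  · rcases hprime.dvd_or_dvd h with h | h
    · obtain ⟨i, hi, hd⟩ := (Prime.dvd_finsetProd_iff hprime _).1 h
      exact hne _ (ht i) (mem_filter.1 hi).2 hd
    · obtain ⟨i, _, hd⟩ := (Prime.dvd_finsetProd_iff hprime _).1 h
      exact hne _ (ht' i) (hcon i) hd

/-- The set of `|n| ≤ N` at which a sum over primes of linear phases is large has size about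
`√N`, when products of `2K` of the primes do not exceed `N`. -/
lemma card_large_values_le {N K M : ℕ} (hN : 1 ≤ N) (P : Finset ℕ) (hP : ∀ p ∈ P, p.Prime)
    (hKP : ∀ p ∈ P, K < p) (hPM : ∀ p ∈ P, p ≤ M) (hM : M ^ (2 * K) ≤ N) (r : ℕ → ℤ)
    (hr : ∀ p ∈ P, ¬ (p : ℤ) ∣ r p) (w : ℕ → ℝ) {L : ℝ} (hL : 0 ≤ L) (D : Finset ℤ)
    (hDN : D ⊆ Icc (-(N : ℤ)) N) (hD : ∀ n ∈ D, L ≤ ‖∑ p ∈ P, (w p : ℂ) * ee (n * (r p / p))‖) :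
    D.card * L ^ (2 * K) ≤ 6 * N * (1 + Real.log N) * (K ^ K : ℕ) * (∑ p ∈ P, w p ^ 2) ^ K := by
  classical
  -- The `K`-th power of the sum over primes is a sum over `K`-tuples `t`, with frequency `∑ r/p`. A
  -- difference of two frequencies has denominator at most `M^(2K) ≤ N`.
  have hls := dual_large_sieve hN (ι := Fin K → P) (fun t => ∑ i, (r (t i) : ℝ) / (t i : ℕ))
    (fun t => ∏ i, w (t i)) (K ^ K) ?_ ?_
  · have e1 : ∀ n : ℤ, ∑ t : Fin K → P, ((∏ i, w (t i) : ℝ) : ℂ)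
        * ee (n * ∑ i, (r (t i) : ℝ) / (t i : ℕ)) = (∑ p ∈ P, (w p : ℂ) * ee (n * (r p / p))) ^ K := by
      intro n
      rw [← sum_coe_sort P (fun p => (w p : ℂ) * ee (n * (r p / p))), Fintype.sum_pow]
      refine sum_congr rfl fun t _ => ?_
      rw [prod_mul_distrib, mul_sum, ee_sum]
      push_cast
      rfl
    have e2 : ∑ t : Fin K → P, (∏ i, w (t i)) ^ 2 = (∑ p ∈ P, w p ^ 2) ^ K := by
      rw [← sum_coe_sort P (fun p => w p ^ 2), Fintype.sum_pow]
      exact sum_congr rfl fun t _ => (prod_pow _ _ _).symm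
    rw [e2] at hls
    simp_rw [e1] at hls
    refine le_trans ?_ hls
    calc (D.card : ℝ) * L ^ (2 * K) = ∑ n ∈ D, L ^ (2 * K) := by rw [sum_const, nsmul_eq_mul]
      _ ≤ ∑ n ∈ D, ‖(∑ p ∈ P, (w p : ℂ) * ee (n * (r p / p))) ^ K‖ ^ 2 := by
          refine sum_le_sum fun n hn => ?_
          rw [norm_pow, ← pow_mul, mul_comm K 2]
          exact pow_le_pow_left₀ hL (hD n hn) _
      _ ≤ _ := sum_le_sum_of_subset_of_nonneg hDN fun _ _ _ => by positivity
  · intro s t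
    refine ⟨(∏ i, (s i : ℕ)) * ∏ i, (t i : ℕ), ?_, ?_, ?_⟩
    · exact Nat.mul_pos (prod_pos fun i _ => (hP _ (s i).2).pos) (prod_pos fun i _ => (hP _ (t i).2).pos)
    · have : ∀ s : Fin K → P, ∏ i, (s i : ℕ) ≤ M ^ K := fun s =>
        (prod_le_pow_card _ _ M fun i _ => hPM _ (s i).2).trans (by simp)
      calc _ ≤ M ^ K * M ^ K := Nat.mul_le_mul (this s) (this t)
        _ = M ^ (2 * K) := by ring
        _ ≤ N := hM
    · obtain ⟨a, ha⟩ := exists_int_sum_div_mul_prod univ (fun i => r (s i)) (fun i => (s i : ℕ))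
        fun i _ => (hP _ (s i).2).ne_zero
      obtain ⟨b, hb⟩ := exists_int_sum_div_mul_prod univ (fun i => r (t i)) (fun i => (t i : ℕ))
        fun i _ => (hP _ (t i).2).ne_zero
      refine ⟨a * ∏ i, (t i : ℤ) - b * ∏ i, (s i : ℤ), ?_⟩
      push_cast
      rw [← ha, ← hb]
      ring
  · intro s T hT
    -- Tuples congruent to `s` use only primes of `s`, so there are at most `K^K` of them.
    have : T ⊆ Fintype.piFinset fun _ => univ.image s := by
      intro t ht
      rw [Fintype.mem_piFinset]
      intro i
      obtain ⟨z, hz⟩ := hT t ht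
      obtain ⟨j, hj⟩ := prime_mem_range_of_sum_sub_sum_int (fun i => (t i : ℕ)) (fun i => (s i : ℕ)) r
        (fun i => hP _ (t i).2) (fun i => hP _ (s i).2) (fun i => hr _ (t i).2)
        (fun i => by simpa using hKP _ (t i).2) hz i
      exact mem_image.2 ⟨j, mem_univ _, Subtype.ext hj⟩
    refine (card_le_card this).trans ?_
    rw [Fintype.card_piFinset, prod_const, card_univ, Fintype.card_fin]
    exact Nat.pow_le_pow_left (card_image_le.trans (by simp)) _

/-! ### Passing to a subset with popular differences. -/

/-- Dependent random choice: a set with many differences in `D` has a large subset almost all of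
whose differences lie in a set not much larger than `D`. -/
lemma exists_subset_popular_differences (A D : Finset ℤ) {γ κ : ℝ} (hγ : 0 < γ) (hκ : 0 < κ)
    (hA : A.Nonempty) (h : γ * A.card ^ 2 ≤ ((A ×ˢ A).filter fun x => x.1 - x.2 ∈ D).card) :
    ∃ A' ⊆ A, ∃ D' : Finset ℤ, γ ^ 2 / 2 * A.card ^ 2 ≤ (A'.card : ℝ) ^ 2 ∧
      D'.card * (κ * γ ^ 2 / 2 * A.card) ≤ (D.card : ℝ) ^ 2 ∧
      (((A' ×ˢ A').filter fun x => x.1 - x.2 ∉ D').card : ℝ) ≤ κ * A'.card ^ 2 := by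
  have hA0 : (0 : ℝ) < A.card := by exact_mod_cast hA.card_pos
  set ν := κ * γ ^ 2 / 2 with hν
  have hν0 : 0 < ν := by positivity
  set rep : ℤ → Finset (ℤ × ℤ) := fun n => (D ×ˢ D).filter fun x => x.1 - x.2 = n with hrep
  -- Popular differences of `D`. The subset will be the neighbourhood `nbr c` of a well chosen `c ∈
  -- A`.
  set D' : Finset ℤ := ((D ×ˢ D).image fun x => x.1 - x.2).filter
    fun n => ν * A.card ≤ (rep n).card with hD'
  set nbr : ℤ → Finset ℤ := fun c => A.filter fun a => a - c ∈ D with hnbr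
  set bad : ℤ → Finset (ℤ × ℤ) := fun c => (nbr c ×ˢ nbr c).filter fun x => x.1 - x.2 ∉ D' with hbad
  have hD'card : D'.card * (ν * A.card) ≤ (D.card : ℝ) ^ 2 := by
    have h1 : ∑ n ∈ D', ν * A.card ≤ ∑ n ∈ D', ((rep n).card : ℝ) :=
      sum_le_sum fun n hn => (mem_filter.1 hn).2
    have h2 : ∑ n ∈ D', (rep n).card ≤ (D ×ˢ D).card := by
      rw [card_eq_sum_card_image (fun x : ℤ × ℤ => x.1 - x.2) (D ×ˢ D)]
      exact sum_le_sum_of_subset (filter_subset _ _)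
    rw [sum_const, nsmul_eq_mul] at h1
    rw [card_product] at h2
    refine h1.trans ?_
    rw [sq]
    exact_mod_cast h2
  have hsum : ∑ c ∈ A, ((nbr c).card : ℝ) = ((A ×ˢ A).filter fun x => x.1 - x.2 ∈ D).card := by
    rw [← Nat.cast_sum, hnbr]
    congr 1
    simp_rw [card_filter]
    rw [sum_product_right]
  have hsq : γ ^ 2 * A.card ^ 3 ≤ ∑ c ∈ A, ((nbr c).card : ℝ) ^ 2 := by
    have h1 := sq_sum_le_card_mul_sum_sq (s := A) (f := fun c => ((nbr c).card : ℝ))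
    rw [hsum] at h1
    have h2 : (γ * A.card ^ 2) ^ 2 ≤ A.card * ∑ c ∈ A, ((nbr c).card : ℝ) ^ 2 :=
      (pow_le_pow_left₀ (by positivity) h 2).trans h1
    have h3 : A.card * (γ ^ 2 * A.card ^ 3) ≤ A.card * ∑ c ∈ A, ((nbr c).card : ℝ) ^ 2 := by
      refine le_trans (le_of_eq ?_) h2; ring
    exact le_of_mul_le_mul_left h3 hA0
  -- Each common neighbour `c` of a pair represents its difference as `(x.1 - c) - (x.2 - c)` with
  -- both terms in `D`, so an unpopular pair has few common neighbours.
  have hbadsum : ∑ c ∈ A, ((bad c).card : ℝ) ≤ ν * A.card ^ 3 := by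
    have e : ∑ c ∈ A, (bad c).card = ∑ x ∈ (A ×ˢ A).filter (fun x => x.1 - x.2 ∉ D'),
        (A.filter fun c => x.1 - c ∈ D ∧ x.2 - c ∈ D).card := by
      have e1 : ∀ c ∈ A, (bad c).card = ∑ x ∈ (A ×ˢ A).filter (fun x => x.1 - x.2 ∉ D'),
          if x.1 - c ∈ D ∧ x.2 - c ∈ D then 1 else 0 := by
        intro c _
        rw [← card_filter]
        congr 1
        ext x
        simp only [hbad, hnbr, mem_filter, mem_product]
        tauto
      rw [sum_congr rfl e1, sum_comm]
      exact sum_congr rfl fun x _ => (card_filter _ _).symm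
    rw [← Nat.cast_sum, e, Nat.cast_sum]
    have h1 : ∀ x ∈ (A ×ˢ A).filter (fun x => x.1 - x.2 ∉ D'),
        ((A.filter fun c => x.1 - c ∈ D ∧ x.2 - c ∈ D).card : ℝ) ≤ ν * A.card := by
      intro x hx
      by_contra! hlt
      set E := A.filter fun c => x.1 - c ∈ D ∧ x.2 - c ∈ D with hE
      have hEr : E.card ≤ (rep (x.1 - x.2)).card := by
        refine card_le_card_of_injOn (fun c => (x.1 - c, x.2 - c)) ?_ ?_
        · intro c hc
          simp only [hE, coe_filter, Set.mem_ofPred_eq] at hc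
          simp only [hrep, coe_filter, Set.mem_ofPred_eq, mem_product]
          exact ⟨hc.2, by ring⟩
        · intro c _ c' _ hcc
          simp only [Prod.mk.injEq] at hcc
          linarith [hcc.1]
      have hEr' : (E.card : ℝ) ≤ (rep (x.1 - x.2)).card := by exact_mod_cast hEr
      refine (mem_filter.1 hx).2 (mem_filter.2 ⟨?_, hlt.le.trans hEr'⟩)
      have hne : E.Nonempty := by
        rw [← card_pos]
        have : (0 : ℝ) < E.card := lt_of_le_of_lt (by positivity) hlt
        exact_mod_cast this
      obtain ⟨c, hc⟩ := hne
      have := (mem_filter.1 hc).2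
      exact mem_image.2 ⟨(x.1 - c, x.2 - c), mem_product.2 this, by ring⟩
    refine (sum_le_card_nsmul _ _ _ h1).trans ?_
    rw [nsmul_eq_mul]
    have h2 : (((A ×ˢ A).filter (fun x => x.1 - x.2 ∉ D')).card : ℝ) ≤ A.card ^ 2 := by
      rw [sq]
      exact_mod_cast (card_filter_le _ _).trans (card_product _ _).le
    calc _ ≤ (A.card : ℝ) ^ 2 * (ν * A.card) := by gcongr
      _ = _ := by ring
  -- Averaging the size and the penalty for bad pairs together makes one `c` satisfy both
  -- requirements.
  have hex : ∃ c ∈ A, γ ^ 2 / 2 * A.card ^ 2 ≤ (nbr c).card ^ 2 - (bad c).card / κ := by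
    refine exists_le_of_sum_le hA ?_
    rw [sum_const, nsmul_eq_mul, sum_sub_distrib, ← sum_div]
    have h1 : (∑ c ∈ A, ((bad c).card : ℝ)) / κ ≤ γ ^ 2 / 2 * A.card ^ 3 := by
      rw [div_le_iff₀ hκ]
      refine hbadsum.trans (le_of_eq ?_)
      rw [hν]; ring
    have : (A.card : ℝ) * (γ ^ 2 / 2 * A.card ^ 2) = γ ^ 2 * A.card ^ 3 - γ ^ 2 / 2 * A.card ^ 3 := by
      ring
    linarith
  obtain ⟨c, _, hc⟩ := hex
  refine ⟨nbr c, filter_subset _ _, D', ?_, hD'card, ?_⟩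
  · have : 0 ≤ ((bad c).card : ℝ) / κ := by positivity
    linarith
  · have h1 : ((bad c).card : ℝ) / κ ≤ (nbr c).card ^ 2 := by
      have : 0 ≤ γ ^ 2 / 2 * (A.card : ℝ) ^ 2 := by positivity
      linarith
    rw [div_le_iff₀ hκ] at h1
    linarith

/-! ### Random sampling of Fourier coefficients. -/

/-- Distinct coordinates of a random tuple are independent, so mean-zero samples are uncorrelated.
The summand is written as a product over all coordinates in order to factor the sum. -/
lemma sum_piFinset_mul_conj_eq_zero {m : ℕ} (A : Finset ℤ) (v : ℤ → ℂ) (hv : ∑ a ∈ A, v a = 0)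
    {i j : Fin m} (hij : i ≠ j) :
    ∑ a ∈ Fintype.piFinset (fun _ : Fin m => A), v (a i) * (starRingEnd ℂ) (v (a j)) = 0 := by
  have h := sum_prod_piFinset A (fun (k : Fin m) x =>
    (if k = i then v x else 1) * (if k = j then (starRingEnd ℂ) (v x) else 1))
  have h0 : ∏ k : Fin m, ∑ x ∈ A,
      (if k = i then v x else 1) * (if k = j then (starRingEnd ℂ) (v x) else 1) = 0 := by
    refine prod_eq_zero (mem_univ i) ?_
    simp [hij, hv]
  rw [h0] at h
  rw [← h]
  refine sum_congr rfl fun a _ => ?_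
  rw [prod_mul_distrib, prod_ite_eq', prod_ite_eq']
  simp

lemma card_filter_piFinset_coord {m : ℕ} (A : Finset ℤ) (q : ℤ → Prop) [DecidablePred q] (i : Fin m) :
    ((Fintype.piFinset (fun _ : Fin m => A)).filter fun a => q (a i)).card
      = (A.filter q).card * A.card ^ (m - 1) := by
  have h := sum_prod_piFinset A (fun (k : Fin m) x => if k = i then (if q x then 1 else 0) else 1)
  have h1 : ∏ k : Fin m, ∑ x ∈ A, (if k = i then (if q x then 1 else 0) else 1)
      = (A.filter q).card * A.card ^ (m - 1) := by
    rw [← mul_prod_erase univ _ (mem_univ i)]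
    congr 1
    · simp
    · rw [prod_congr rfl (g := fun _ => A.card) fun k hk => by simp [ne_of_mem_erase hk], prod_const,
        card_erase_of_mem (mem_univ i), card_univ, Fintype.card_fin]
  rw [h1] at h
  rw [← h, card_filter]
  refine sum_congr rfl fun a _ => ?_
  rw [prod_ite_eq']
  simp

/-- The variance of the mean of `m` samples. -/
lemma sum_sq_norm_sample_mean_sub_le {m : ℕ} (hm : 1 ≤ m) (A : Finset ℤ) (hA : A.Nonempty)
    (u : ℤ → ℂ) (hu : ∀ a, ‖u a‖ ≤ 1) :
    ∑ a ∈ Fintype.piFinset (fun _ : Fin m => A),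
      ‖(∑ i, u (a i)) / m - (∑ a ∈ A, u a) / A.card‖ ^ 2 ≤ 4 / m * (A.card : ℝ) ^ m := by
  have hA0 : (0 : ℝ) < A.card := by exact_mod_cast hA.card_pos
  have hm0 : (0 : ℝ) < m := by exact_mod_cast hm
  have hm0' : (m : ℂ) ≠ 0 := by exact_mod_cast hm0.ne'
  have hA0' : (A.card : ℂ) ≠ 0 := by exact_mod_cast hA0.ne'
  set μ := (∑ a ∈ A, u a) / A.card with hμ
  set v : ℤ → ℂ := fun a => u a - μ with hv
  have hv0 : ∑ a ∈ A, v a = 0 := by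
    rw [hv, sum_sub_distrib, sum_const, nsmul_eq_mul, hμ]
    field_simp
    ring
  have hμ1 : ‖μ‖ ≤ 1 := by
    rw [hμ, norm_div, Complex.norm_natCast, div_le_one hA0]
    refine (norm_sum_le _ _).trans ((sum_le_card_nsmul _ _ 1 fun a _ => hu a).trans (by simp))
  have hv2 : ∀ a, ‖v a‖ ≤ 2 := fun a => (norm_sub_le _ _).trans (by linarith [hu a])
  have e1 : ∀ a : Fin m → ℤ, ‖(∑ i, u (a i)) / m - μ‖ ^ 2 = ‖∑ i, v (a i)‖ ^ 2 / m ^ 2 := by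
    intro a
    have : (∑ i, u (a i)) / m - μ = (∑ i, v (a i)) / m := by
      rw [hv, sum_sub_distrib, sum_const, card_univ, Fintype.card_fin, nsmul_eq_mul]
      field_simp
    rw [this, norm_div, Complex.norm_natCast, div_pow]
  have e2 : ((∑ a ∈ Fintype.piFinset (fun _ : Fin m => A), ‖∑ i, v (a i)‖ ^ 2 : ℝ) : ℂ)
      = ∑ i : Fin m, ((∑ a ∈ Fintype.piFinset (fun _ : Fin m => A), ‖v (a i)‖ ^ 2 : ℝ) : ℂ) := by
    have : ∀ a : Fin m → ℤ, ((‖∑ i, v (a i)‖ ^ 2 : ℝ) : ℂ)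
        = ∑ i, ∑ j, v (a i) * (starRingEnd ℂ) (v (a j)) := by
      intro a
      rw [Complex.ofReal_pow, ← Complex.mul_conj', map_sum, sum_mul_sum]
    rw [Complex.ofReal_sum, sum_congr rfl fun a _ => this a, sum_comm]
    refine sum_congr rfl fun i _ => ?_
    rw [sum_comm, sum_eq_single i]
    · rw [Complex.ofReal_sum]
      refine sum_congr rfl fun a _ => ?_
      rw [Complex.mul_conj']
      push_cast
      rfl
    · intro j _ hj
      exact sum_piFinset_mul_conj_eq_zero A v hv0 hj.symm
    · intro h
      exact absurd (mem_univ i) h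
  have e3 : ∑ a ∈ Fintype.piFinset (fun _ : Fin m => A), ‖∑ i, v (a i)‖ ^ 2
      = ∑ i : Fin m, ∑ a ∈ Fintype.piFinset (fun _ : Fin m => A), ‖v (a i)‖ ^ 2 := by
    exact_mod_cast e2
  have e4 : ∑ i : Fin m, ∑ a ∈ Fintype.piFinset (fun _ : Fin m => A), ‖v (a i)‖ ^ 2
      ≤ m * ((A.card : ℝ) ^ m * 4) := by
    calc _ ≤ ∑ i : Fin m, ∑ a ∈ Fintype.piFinset (fun _ : Fin m => A), (4 : ℝ) := by
          refine sum_le_sum fun i _ => sum_le_sum fun a _ => ?_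
          nlinarith [hv2 (a i), norm_nonneg (v (a i))]
      _ = _ := by
          simp [Fintype.card_piFinset]
  rw [sum_congr rfl fun a _ => e1 a, ← sum_div, e3, div_le_iff₀ (by positivity)]
  refine e4.trans (le_of_eq ?_)
  field_simp

/-- Many translates of a set `A` agree, in the mean square sense, on a fixed `m`-tuple. -/
lemma exists_common_sample {m : ℕ} (hm : 1 ≤ m) (A D : Finset ℤ) (hA : A.Nonempty)
    (hbad : (((A ×ˢ A).filter fun x => x.1 - x.2 ∉ D).card : ℝ) ≤ 1 / (4 * m) * A.card ^ 2)
    (P : Finset ℕ) (w : ℕ → ℝ) (hw : ∀ p ∈ P, 0 ≤ w p) (hW : 0 < ∑ p ∈ P, w p)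
    (u : ℕ → ℤ → ℂ) (hu : ∀ p a, ‖u p a‖ ≤ 1) :
    ∃ x : Fin m → ℤ, ∃ T ⊆ A, (A.card : ℝ) ^ (m + 1) ≤ 2 * D.card ^ m * T.card ∧
      ∀ b ∈ T, ∑ p ∈ P, w p * ‖(∑ i, u p (x i + b)) / m - (∑ a ∈ A, u p a) / A.card‖ ^ 2
        ≤ 16 / m * ∑ p ∈ P, w p := by
  classical
  have hA0 : (0 : ℝ) < A.card := by exact_mod_cast hA.card_pos
  have hm0 : (0 : ℝ) < m := by exact_mod_cast hm
  set W := ∑ p ∈ P, w p with hWdef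
  set V := Fintype.piFinset (fun _ : Fin m => A) with hV
  have hVcard : V.card = A.card ^ m := by simp [hV, Fintype.card_piFinset]
  set G : (Fin m → ℤ) → ℝ := fun a =>
    ∑ p ∈ P, w p * ‖(∑ i, u p (a i)) / m - (∑ a ∈ A, u p a) / A.card‖ ^ 2 with hG
  have hGnn : ∀ a, 0 ≤ G a := fun a => sum_nonneg fun p hp => mul_nonneg (hw p hp) (by positivity)
  have hGsum : ∑ a ∈ V, G a ≤ W * (4 / m * (A.card : ℝ) ^ m) := by
    rw [hG, sum_comm, hWdef, sum_mul]
    refine sum_le_sum fun p hp => ?_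
    rw [← mul_sum]
    exact mul_le_mul_of_nonneg_left (sum_sq_norm_sample_mean_sub_le hm A hA (u p) (hu p)) (hw p hp)
  -- Markov's inequality: the threshold is four times the mean, so at most a quarter of the samples
  -- are lost.
  set X₁ := V.filter fun a => ¬ G a ≤ 16 / m * W with hX₁
  have hX₁card : (X₁.card : ℝ) ≤ 1 / 4 * A.card ^ m := by
    have h1 : X₁.card * (16 / m * W) ≤ ∑ a ∈ X₁, G a := by
      rw [← nsmul_eq_mul]
      exact card_nsmul_le_sum _ _ _ fun a ha => (not_le.1 (mem_filter.1 ha).2).le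
    have h2 : ∑ a ∈ X₁, G a ≤ ∑ a ∈ V, G a :=
      sum_le_sum_of_subset_of_nonneg (filter_subset _ _) fun a _ _ => hGnn a
    have h3 : (X₁.card : ℝ) * (16 / m * W) ≤ (1 / 4 * A.card ^ m) * (16 / m * W) := by
      refine (h1.trans (h2.trans hGsum)).trans (le_of_eq ?_)
      ring
    exact le_of_mul_le_mul_right h3 (by positivity)
  -- A union bound over `m` coordinates, each failing with density at most `1/(4m)`, loses another
  -- quarter. Half of the pairs (base point, sample) survive in `Ω`.
  set X₂ : Fin m → Finset (ℤ × (Fin m → ℤ)) := fun i => (A ×ˢ V).filter fun y => y.2 i - y.1 ∉ D with hX₂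
  have hX₂card : ∀ i, ((X₂ i).card : ℝ) ≤ 1 / (4 * m) * A.card ^ (m + 1) := by
    intro i
    have h1 : (X₂ i).card
        = ((A ×ˢ A).filter fun x => x.1 - x.2 ∉ D).card * A.card ^ (m - 1) := by
      simp only [hX₂]
      rw [card_filter, sum_product, card_filter, sum_product_right, sum_mul]
      refine sum_congr rfl fun b _ => ?_
      rw [← card_filter, ← card_filter]
      exact card_filter_piFinset_coord A (fun x => x - b ∉ D) i
    rw [h1]
    push_cast
    calc _ ≤ 1 / (4 * m) * (A.card : ℝ) ^ 2 * (A.card : ℝ) ^ (m - 1) := by gcongr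
      _ = _ := by
        rw [mul_assoc, ← pow_add]
        congr 2
        omega
  set Ω := (A ×ˢ V).filter fun y => G y.2 ≤ 16 / m * W ∧ ∀ i, y.2 i - y.1 ∈ D with hΩ
  have hcover : A ×ˢ V ⊆ Ω ∪ (A ×ˢ X₁ ∪ univ.biUnion X₂) := by
    intro y hy
    have hy' := mem_product.1 hy
    by_cases h1 : G y.2 ≤ 16 / m * W
    · by_cases h2 : ∀ i, y.2 i - y.1 ∈ D
      · exact mem_union_left _ (mem_filter.2 ⟨hy, h1, h2⟩)
      · push Not at h2
        obtain ⟨i, hi⟩ := h2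
        exact mem_union_right _ (mem_union_right _ (mem_biUnion.2
          ⟨i, mem_univ _, mem_filter.2 ⟨hy, hi⟩⟩))
    · exact mem_union_right _ (mem_union_left _ (mem_product.2 ⟨hy'.1, mem_filter.2 ⟨hy'.2, h1⟩⟩))
  have hΩcard : (A.card : ℝ) ^ (m + 1) / 2 ≤ Ω.card := by
    have h1 : ((A ×ˢ V).card : ℝ) ≤ Ω.card + ((A ×ˢ X₁).card + ∑ i, ((X₂ i).card : ℝ)) := by
      have := (card_le_card hcover).trans ((card_union_le _ _).trans
        (Nat.add_le_add_left ((card_union_le _ _).trans (Nat.add_le_add_left card_biUnion_le _)) _))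
      exact_mod_cast this
    have h2 : ∑ i, ((X₂ i).card : ℝ) ≤ 1 / 4 * (A.card : ℝ) ^ (m + 1) := by
      refine (sum_le_card_nsmul _ _ _ fun i _ => hX₂card i).trans (le_of_eq ?_)
      rw [card_univ, Fintype.card_fin, nsmul_eq_mul]
      field_simp
    rw [card_product, card_product, hVcard] at h1
    push_cast at h1
    have h3 : (A.card : ℝ) * X₁.card ≤ 1 / 4 * A.card ^ (m + 1) := by
      calc (A.card : ℝ) * X₁.card ≤ A.card * (1 / 4 * A.card ^ m) := by gcongr
        _ = _ := by ring
    rw [pow_succ'] at *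
    linarith
  have hΩpos : (0 : ℝ) < Ω.card := lt_of_lt_of_le (by positivity) hΩcard
  have hmaps : ∀ y ∈ Ω, (fun i => y.2 i - y.1) ∈ Fintype.piFinset (fun _ : Fin m => D) := by
    intro y hy
    exact Fintype.mem_piFinset.2 (mem_filter.1 hy).2.2
  obtain ⟨y₀, hy₀⟩ : Ω.Nonempty := card_pos.1 (by exact_mod_cast hΩpos)
  have hDcard : (Fintype.piFinset (fun _ : Fin m => D)).card = D.card ^ m := by
    simp [Fintype.card_piFinset]
  have hDpos : (0 : ℝ) < (D.card : ℝ) ^ m := by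
    have : 0 < (Fintype.piFinset (fun _ : Fin m => D)).card := card_pos.2 ⟨_, hmaps y₀ hy₀⟩
    rw [hDcard] at this
    exact_mod_cast this
  -- Pigeonhole over the `|D|^m` possible difference tuples `a - b`.
  obtain ⟨x, _, hx⟩ := exists_le_card_fiber_of_nsmul_le_card_of_maps_to
    (s := Ω) (t := Fintype.piFinset (fun _ : Fin m => D)) (f := fun y i => y.2 i - y.1)
    (b := (Ω.card : ℝ) / (D.card : ℝ) ^ m) hmaps ⟨_, hmaps y₀ hy₀⟩ (by
      rw [hDcard, nsmul_eq_mul]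
      push_cast
      rw [mul_div_cancel₀ _ hDpos.ne'])
  set Φ := Ω.filter fun y => (fun i => y.2 i - y.1) = x with hΦ
  have hinj : Set.InjOn Prod.fst (Φ : Set (ℤ × (Fin m → ℤ))) := by
    intro y hy y' hy' hyy
    have h1 := (mem_filter.1 hy).2
    have h2 := (mem_filter.1 hy').2
    refine Prod.ext hyy (funext fun i => ?_)
    have h3 := congrFun h1 i
    have h4 := congrFun h2 i
    rw [hyy] at h3
    linarith
  refine ⟨x, Φ.image Prod.fst, ?_, ?_, ?_⟩
  · intro b hb
    obtain ⟨y, hy, rfl⟩ := mem_image.1 hb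
    exact (mem_product.1 (mem_filter.1 (mem_filter.1 hy).1).1).1
  · rw [card_image_of_injOn hinj]
    rw [div_le_iff₀ hDpos] at hx
    linarith
  · intro b hb
    obtain ⟨y, hy, rfl⟩ := mem_image.1 hb
    have h1 := (mem_filter.1 (mem_filter.1 hy).1).2.1
    have h2 : ∀ i, x i + y.1 = y.2 i := fun i => by
      rw [← (mem_filter.1 hy).2]; ring
    simp_rw [h2]
    exact h1

/-! ### Gallagher's larger sieve under approximate phase constraints. -/

lemma sum_log_primes_dvd_le (P : Finset ℕ) (hP : ∀ p ∈ P, p.Prime) {n : ℤ} (hn : n ≠ 0) :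
    ∑ p ∈ P.filter (fun p : ℕ => (p : ℤ) ∣ n), Real.log p ≤ Real.log |n| := by
  have hn' : n.natAbs ≠ 0 := Int.natAbs_ne_zero.2 hn
  have h1 : ∏ p ∈ P.filter (fun p : ℕ => (p : ℤ) ∣ n), p ≤ n.natAbs := by
    refine Nat.le_of_dvd (Nat.pos_of_ne_zero hn') (prod_primes_dvd _ ?_ ?_)
    · intro p hp
      exact (hP p (mem_filter.1 hp).1).prime
    · intro p hp
      exact Int.natCast_dvd.1 (mem_filter.1 hp).2
  rw [← Real.log_prod (fun p hp => by
    exact_mod_cast (hP p (mem_filter.1 hp).1).ne_zero)]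
  refine Real.log_le_log (prod_pos fun p hp => by exact_mod_cast (hP p (mem_filter.1 hp).1).pos) ?_
  have h2 : ((∏ p ∈ P.filter (fun p : ℕ => (p : ℤ) ∣ n), p : ℕ) : ℝ) ≤ (n.natAbs : ℝ) := by
    exact_mod_cast h1
  push_cast at h2
  rwa [Nat.cast_natAbs, Int.cast_abs] at h2

/-- The counting inequality behind Gallagher's larger sieve. -/
lemma larger_sieve {N : ℕ} (T : Finset ℤ) (hT : T ⊆ Icc 1 (N : ℤ)) (P : Finset ℕ)
    (hP : ∀ p ∈ P, p.Prime) :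
    ∑ p ∈ P, Real.log p * ((T ×ˢ T).filter fun x => (p : ℤ) ∣ x.1 - x.2).card
      ≤ T.card ^ 2 * Real.log N + T.card * ∑ p ∈ P, Real.log p := by
  have hlog : ∀ p ∈ P, 0 ≤ Real.log p := fun p _ => Real.log_natCast_nonneg p
  have e : ∑ p ∈ P, Real.log p * ((T ×ˢ T).filter fun x => (p : ℤ) ∣ x.1 - x.2).card
      = ∑ x ∈ T ×ˢ T, ∑ p ∈ P.filter (fun p : ℕ => (p : ℤ) ∣ x.1 - x.2), Real.log p := by
    simp_rw [card_filter, sum_filter, Nat.cast_sum, mul_sum]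
    rw [sum_comm]
    refine sum_congr rfl fun x _ => sum_congr rfl fun p _ => ?_
    split_ifs <;> simp
  rw [e]
  have h : ∀ x ∈ T ×ˢ T, ∑ p ∈ P.filter (fun p : ℕ => (p : ℤ) ∣ x.1 - x.2), Real.log p
      ≤ Real.log N + if x.1 = x.2 then ∑ p ∈ P, Real.log p else 0 := by
    intro x hx
    rw [mem_product] at hx
    split_ifs with hxx
    · have h1 : ∑ p ∈ P.filter (fun p : ℕ => (p : ℤ) ∣ x.1 - x.2), Real.log p ≤ ∑ p ∈ P, Real.log p :=
        sum_le_sum_of_subset_of_nonneg (filter_subset _ _) fun p hp _ => hlog p hp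
      linarith [Real.log_natCast_nonneg N]
    · have h0 : x.1 - x.2 ≠ 0 := sub_ne_zero.2 hxx
      rw [add_zero]
      refine (sum_log_primes_dvd_le P hP h0).trans (Real.log_le_log ?_ ?_)
      · exact_mod_cast abs_pos.2 h0
      · have h1 := mem_Icc.1 (hT hx.1)
        have h2 := mem_Icc.1 (hT hx.2)
        have : |x.1 - x.2| ≤ (N : ℤ) := by rw [abs_le]; constructor <;> linarith
        exact_mod_cast this
  refine (sum_le_sum h).trans (le_of_eq ?_)
  rw [sum_add_distrib, sum_const, card_product, nsmul_eq_mul, sum_product]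
  congr 1
  · push_cast; ring
  · rw [sum_congr rfl fun a ha => by rw [sum_ite_eq, if_pos ha], sum_const, nsmul_eq_mul]

/-- Cauchy–Schwarz over the fibres of `g`. -/
lemma sq_card_le_card_image_mul {α β : Type*} [DecidableEq α] [DecidableEq β] (T : Finset α)
    (g : α → β) (E : Finset β) (hE : ∀ b ∈ T, g b ∈ E) :
    T.card ^ 2 ≤ E.card * ((T ×ˢ T).filter fun x => g x.1 = g x.2).card := by
  have h1 : T.card = ∑ e ∈ E, (T.filter fun b => g b = e).card :=
    card_eq_sum_card_fiberwise hE
  have h2 : ((T ×ˢ T).filter fun x => g x.1 = g x.2).card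
      = ∑ e ∈ E, (T.filter fun b => g b = e).card ^ 2 := by
    rw [card_eq_sum_card_fiberwise (f := fun x : α × α => g x.1) (t := E)]
    · refine sum_congr rfl fun e _ => ?_
      rw [sq, ← card_product]
      congr 1
      ext x
      simp only [mem_filter, mem_product]
      constructor
      · rintro ⟨⟨⟨h1, h2⟩, h3⟩, h4⟩
        exact ⟨⟨h1, h4⟩, h2, h3 ▸ h4⟩
      · rintro ⟨⟨h1, h4⟩, h2, h5⟩
        exact ⟨⟨⟨h1, h2⟩, h4.trans h5.symm⟩, h4⟩
    · intro x hx
      exact hE _ (mem_product.1 (mem_filter.1 hx).1).1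
  rw [h1, h2]
  exact sq_sum_le_card_mul_sum_sq

/-- Integers whose multiples `ρ b / p` are close modulo `1` occupy few residue classes. -/
lemma sq_card_le_of_phases_close {p : ℕ} (hp : p.Prime) {ρ : ℤ} (hρ : ¬ (p : ℤ) ∣ ρ) {σ : ℝ}
    (hσ : 1 ≤ σ * p) (T : Finset ℤ)
    (hT : ∀ b ∈ T, ∀ b' ∈ T, ‖ee (ρ * b / p) - ee (ρ * b' / p)‖ ≤ 4 * σ) :
    (T.card : ℝ) ^ 2 ≤ 3 * σ * p * ((T ×ˢ T).filter fun x => (p : ℤ) ∣ x.1 - x.2).card := by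
  rcases T.eq_empty_or_nonempty with rfl | ⟨b₀, hb₀⟩
  · simp
  have hp0 : (0 : ℝ) < p := by exact_mod_cast hp.pos
  have hpz : (0 : ℤ) < p := by exact_mod_cast hp.pos
  set g : ℤ → ℤ := fun b => (ρ * (b - b₀)) % p with hg
  set F : ℤ := ⌊σ * p⌋ with hF
  -- The nearly agreeing phases allow `2F + 1` residues; `F ≥ 1` bounds this by `3F`.
  have hF1 : 1 ≤ F := Int.le_floor.2 (by exact_mod_cast hσ)
  set E : Finset ℤ := Icc 0 F ∪ Icc (p - F) (p - 1) with hE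
  have hEcard : (E.card : ℝ) ≤ 3 * σ * p := by
    have h1 : E.card ≤ (F + 1 - 0).toNat + ((p : ℤ) - 1 + 1 - (p - F)).toNat := by
      have := card_union_le (Icc 0 F) (Icc ((p : ℤ) - F) (p - 1))
      rwa [Int.card_Icc, Int.card_Icc] at this
    have h2 : (E.card : ℤ) ≤ 3 * F := by omega
    have h3 : (F : ℝ) ≤ σ * p := Int.floor_le _
    have h4 : (E.card : ℝ) ≤ 3 * F := by exact_mod_cast h2
    linarith
  have hgE : ∀ b ∈ T, g b ∈ E := by
    intro b hb
    have hmod0 := Int.emod_nonneg (ρ * (b - b₀)) hpz.ne'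
    have hmod1 := Int.emod_lt_of_pos (ρ * (b - b₀)) hpz
    have hdiv := Int.emod_add_mul_ediv (ρ * (b - b₀)) p
    change 0 ≤ g b at hmod0
    change g b < p at hmod1
    set z := ρ * (b - b₀) / p with hz
    have hdiv' : (ρ : ℝ) * (b - b₀) = g b + p * z := by
      have : ρ * (b - b₀) = g b + p * z := hdiv.symm
      exact_mod_cast this
    have h1 : ee (ρ * b / p) = ee (ρ * b₀ / p) * ee (g b / p) := by
      rw [← ee_add, ← ee_add_int _ (-z)]
      congr 1
      push_cast
      field_simp
      linarith
    have h2 := hT b hb b₀ hb₀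
    rw [h1, show ee (ρ * b₀ / p) * ee (g b / p) - ee (ρ * b₀ / p)
      = ee (ρ * b₀ / p) * (ee (g b / p) - 1) by ring, norm_mul, norm_ee, one_mul] at h2
    have hm0' : (0 : ℝ) ≤ g b := by exact_mod_cast hmod0
    have hm1' : (g b : ℝ) ≤ p := by exact_mod_cast hmod1.le
    have h3 := four_mul_min_le_norm_ee_sub_one (t := (g b : ℝ) / p) (by positivity)
      ((div_le_one hp0).2 hm1')
    have h4 : min ((g b : ℝ) / p) (1 - g b / p) ≤ σ := by linarith
    rw [hE, mem_union, mem_Icc, mem_Icc]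
    rcases min_le_iff.1 h4 with h | h
    · left
      rw [div_le_iff₀ hp0] at h
      exact ⟨hmod0, Int.le_floor.2 h⟩
    · right
      have : ((p - g b : ℤ) : ℝ) ≤ σ * p := by
        rw [sub_le_iff_le_add, ← sub_le_iff_le_add', le_div_iff₀ hp0] at h
        push_cast
        linarith
      have := Int.le_floor.2 this
      constructor
      · linarith
      · linarith
  have h := sq_card_le_card_image_mul T g E hgE
  have hsub : ((T ×ˢ T).filter fun x => g x.1 = g x.2)
      ⊆ (T ×ˢ T).filter fun x => (p : ℤ) ∣ x.1 - x.2 := by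
    intro x hx
    rw [mem_filter] at hx ⊢
    refine ⟨hx.1, ?_⟩
    have h1 : (p : ℤ) ∣ ρ * (x.1 - b₀) - ρ * (x.2 - b₀) := Int.ModEq.dvd (Eq.symm hx.2)
    have h2 : (p : ℤ) ∣ ρ * (x.1 - x.2) := by
      rwa [← mul_sub, sub_sub_sub_cancel_right] at h1
    exact ((Nat.prime_iff_prime_int.1 hp).dvd_or_dvd h2).resolve_left hρ
  calc (T.card : ℝ) ^ 2
      ≤ E.card * ((T ×ˢ T).filter fun x => g x.1 = g x.2).card := by exact_mod_cast h
    _ ≤ 3 * σ * p * ((T ×ˢ T).filter fun x => (p : ℤ) ∣ x.1 - x.2).card := by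
        have : (((T ×ˢ T).filter fun x => g x.1 = g x.2).card : ℝ)
            ≤ ((T ×ˢ T).filter fun x => (p : ℤ) ∣ x.1 - x.2).card := by
          exact_mod_cast card_le_card hsub
        have : 0 ≤ 3 * σ * p := by linarith
        gcongr

/-- A set whose elements have nearly the same phases for most primes is small. -/
lemma larger_sieve_of_common_phases {N : ℕ} (T : Finset ℤ) (hT : T ⊆ Icc 1 (N : ℤ))
    (hTne : T.Nonempty) (P : Finset ℕ) (hP : ∀ p ∈ P, p.Prime) (ρ : ℕ → ℤ)
    (hρ : ∀ p ∈ P, ¬ (p : ℤ) ∣ ρ p) (z μ : ℕ → ℂ) {τ δ : ℝ} (hτ : 0 < τ) (hτδ : 2 * τ ≤ δ)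
    (hμ : ∀ p ∈ P, δ ≤ ‖μ p‖) (hPτ : ∀ p ∈ P, δ ≤ τ * p)
    (hW : 0 < ∑ p ∈ P, Real.log p / p)
    (hclose : ∀ b ∈ T, ∑ p ∈ P, Real.log p / p * ‖ee (ρ p * b / p) * z p - μ p‖ ^ 2
      ≤ τ ^ 2 / 2 * ∑ p ∈ P, Real.log p / p) :
    (∑ p ∈ P, Real.log p / p) * T.card
      ≤ 12 * (τ / δ) * (T.card * Real.log N + ∑ p ∈ P, Real.log p) := by
  classical
  have hδ : 0 < δ := by linarith
  set w : ℕ → ℝ := fun p => Real.log p / p with hwdef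
  have hw : ∀ p ∈ P, 0 ≤ w p := fun p _ => div_nonneg (Real.log_natCast_nonneg p) (Nat.cast_nonneg _)
  set W := ∑ p ∈ P, w p with hWdef
  set Tp : ℕ → Finset ℤ := fun p => T.filter fun b => ‖ee (ρ p * b / p) * z p - μ p‖ ≤ τ with hTp
  have hT0 : (0 : ℝ) < T.card := by exact_mod_cast hTne.card_pos
  have hweight : W * T.card / 2 ≤ ∑ p ∈ P, w p * (Tp p).card := by
    have e : ∑ p ∈ P, w p * (Tp p).card
        = ∑ b ∈ T, ∑ p ∈ P, if ‖ee (ρ p * b / p) * z p - μ p‖ ≤ τ then w p else 0 := by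
      simp_rw [hTp, card_filter, Nat.cast_sum, mul_sum]
      rw [sum_comm]
      refine sum_congr rfl fun x _ => sum_congr rfl fun p _ => ?_
      split_ifs <;> simp
    rw [e]
    -- Chebyshev's inequality: for each `b`, primes with error above `τ` carry at most half the
    -- weight.
    have h1 : ∀ b ∈ T, W / 2 ≤ ∑ p ∈ P, if ‖ee (ρ p * b / p) * z p - μ p‖ ≤ τ then w p else 0 := by
      intro b hb
      have h2 : ∀ p ∈ P, τ ^ 2 * w p ≤ w p * ‖ee (ρ p * b / p) * z p - μ p‖ ^ 2
          + τ ^ 2 * if ‖ee (ρ p * b / p) * z p - μ p‖ ≤ τ then w p else 0 := by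
        intro p hp
        split_ifs with h
        · have : 0 ≤ w p * ‖ee (ρ p * b / p) * z p - μ p‖ ^ 2 := mul_nonneg (hw p hp) (by positivity)
          linarith
        · push Not at h
          have : τ ^ 2 ≤ ‖ee (ρ p * b / p) * z p - μ p‖ ^ 2 := by gcongr
          nlinarith [hw p hp]
      have h3 := sum_le_sum h2
      rw [sum_add_distrib, ← mul_sum, ← mul_sum] at h3
      have h4 := hclose b hb
      have h5 : τ ^ 2 * (W / 2) ≤ τ ^ 2 *
          ∑ p ∈ P, if ‖ee (ρ p * b / p) * z p - μ p‖ ≤ τ then w p else 0 := by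
        have : τ ^ 2 * W = τ ^ 2 * (W / 2) + τ ^ 2 / 2 * W := by ring
        linarith
      exact le_of_mul_le_mul_left h5 (by positivity)
    have := card_nsmul_le_sum _ _ _ h1
    rw [nsmul_eq_mul] at this
    linarith
  -- Weighted Cauchy–Schwarz passes from the sizes of the `Tp p` to pair counts, which become
  -- collision counts modulo `p`.
  have hcs : (∑ p ∈ P, w p * (Tp p).card) ^ 2 ≤ W * ∑ p ∈ P, w p * (Tp p).card ^ 2 := by
    refine sum_sq_le_sum_mul_sum_of_sq_le_mul P hw
      (fun p hp => mul_nonneg (hw p hp) (by positivity)) fun p _ => le_of_eq (by ring)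
  have hcoll : ∀ p ∈ P, w p * (Tp p).card ^ 2 ≤ 3 * (τ / δ) *
      (Real.log p * ((T ×ˢ T).filter fun x => (p : ℤ) ∣ x.1 - x.2).card) := by
    intro p hp
    have hp0 : (0 : ℝ) < p := by exact_mod_cast (hP p hp).pos
    have h1 := sq_card_le_of_phases_close (hP p hp) (hρ p hp) (σ := τ / δ) (by
      rw [div_mul_eq_mul_div, le_div_iff₀ hδ]; linarith [hPτ p hp]) (Tp p) (by
      intro b hb b' hb'
      have e1 := (mem_filter.1 hb).2
      have e2 := (mem_filter.1 hb').2
      have e3 : ‖z p‖ * ‖ee (ρ p * b / p) - ee (ρ p * b' / p)‖ ≤ 2 * τ := by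
        rw [← norm_mul]
        have : z p * (ee (ρ p * b / p) - ee (ρ p * b' / p))
          = (ee (ρ p * b / p) * z p - μ p) - (ee (ρ p * b' / p) * z p - μ p) := by ring
        rw [this]
        exact (norm_sub_le _ _).trans (by linarith)
      -- The common factor `z p` cannot be small since `μ p` is not. Dividing by it turns error `2τ`
      -- into `4τ/δ`.
      have e4 : δ / 2 ≤ ‖z p‖ := by
        have h1 := norm_sub_norm_le (μ p) (ee (ρ p * b / p) * z p)
        rw [norm_sub_rev, norm_mul, norm_ee, one_mul] at h1
        linarith [hμ p hp]
      have e5 : δ / 2 * ‖ee (ρ p * b / p) - ee (ρ p * b' / p)‖ ≤ 2 * τ :=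
        (mul_le_mul_of_nonneg_right e4 (norm_nonneg _)).trans e3
      rw [mul_div_assoc', le_div_iff₀ hδ]
      linarith)
    have h2 : (((Tp p ×ˢ Tp p).filter fun x => (p : ℤ) ∣ x.1 - x.2).card : ℝ)
        ≤ ((T ×ˢ T).filter fun x => (p : ℤ) ∣ x.1 - x.2).card := by
      exact_mod_cast card_le_card (filter_subset_filter _
        (product_subset_product (filter_subset _ _) (filter_subset _ _)))
    calc w p * (Tp p).card ^ 2
        ≤ w p * (3 * (τ / δ) * p * ((T ×ˢ T).filter fun x => (p : ℤ) ∣ x.1 - x.2).card) := by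
          refine mul_le_mul_of_nonneg_left (h1.trans ?_) (hw p hp)
          gcongr
      _ = _ := by
        rw [hwdef]; field_simp
  have hls := larger_sieve T hT P hP
  have h1 : (W * T.card / 2) ^ 2 ≤ W * (3 * (τ / δ) *
      (T.card ^ 2 * Real.log N + T.card * ∑ p ∈ P, Real.log p)) := by
    refine (pow_le_pow_left₀ (by positivity) hweight 2).trans (hcs.trans ?_)
    refine mul_le_mul_of_nonneg_left ((sum_le_sum hcoll).trans ?_) hW.le
    rw [← mul_sum]
    gcongr
  have h2 : (W * T.card / 4) * (W * T.card) ≤ (W * T.card / 4) *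
      (12 * (τ / δ) * (T.card * Real.log N + ∑ p ∈ P, Real.log p)) := by
    refine le_trans (le_of_eq ?_) (h1.trans (le_of_eq ?_)) <;> ring
  exact le_of_mul_le_mul_left h2 (by positivity)

/-! ### Mertens' first theorem. -/

lemma log_factorial_eq_sum_primes (n : ℕ) :
    Real.log (n.factorial) = ∑ p ∈ (Icc 1 n).filter Nat.Prime, n.factorial.factorization p * Real.log p := by
  have h0 := n.factorial_ne_zero
  conv_lhs => rw [← Nat.prod_factorization_pow_eq_self h0]
  rw [Finsupp.prod, Nat.cast_prod, Real.log_prod]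
  · rw [Nat.support_factorization]
    simp_rw [Nat.cast_pow, Real.log_pow]
    refine sum_subset ?_ ?_
    · intro p hp
      have hp' := Nat.prime_of_mem_primeFactors hp
      rw [mem_filter, mem_Icc]
      exact ⟨⟨hp'.one_le, (Nat.Prime.dvd_factorial hp').1 (Nat.dvd_of_mem_primeFactors hp)⟩, hp'⟩
    · intro p _ hp
      rw [← Nat.support_factorization, Finsupp.notMem_support_iff] at hp
      rw [hp]; simp
  · intro p hp
    rw [Nat.support_factorization] at hp
    exact_mod_cast pow_ne_zero _ (Nat.prime_of_mem_primeFactors hp).ne_zero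

lemma sum_log_primes_Icc_le (n : ℕ) :
    ∑ p ∈ (Icc 1 n).filter Nat.Prime, Real.log p ≤ Real.log 4 * n := by
  have h := Chebyshev.theta_le_log4_mul_x (x := n) (Nat.cast_nonneg n)
  unfold Chebyshev.theta at h
  rw [Nat.floor_natCast] at h
  exact h

/-- Factor `n!`: each prime has exponent at least `⌊n/p⌋`, and the rounding costs at most `∑ log p ≤
n log 4`. -/
lemma sum_log_div_primes_le {n : ℕ} (hn : 1 ≤ n) :
    ∑ p ∈ (Icc 1 n).filter Nat.Prime, Real.log p / p ≤ Real.log n + Real.log 4 := by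
  have hn0 : (0 : ℝ) < n := by exact_mod_cast hn
  have h1 : ∀ p ∈ (Icc 1 n).filter Nat.Prime,
      n * (Real.log p / p) ≤ n.factorial.factorization p * Real.log p + Real.log p := by
    intro p hp
    have hp' := (mem_filter.1 hp).2
    have hp0 : (0 : ℝ) < p := by exact_mod_cast hp'.pos
    have h2 : n / p ≤ n.factorial.factorization p := by
      rw [Nat.factorization_factorial hp' (b := Nat.log p n + 2) (by omega)]
      calc n / p = n / p ^ 1 := by rw [pow_one]
        _ ≤ _ := single_le_sum (f := fun i => n / p ^ i) (fun _ _ => Nat.zero_le _)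
          (mem_Ico.2 ⟨le_rfl, by omega⟩)
    have h3 : (n : ℝ) / p ≤ n.factorial.factorization p + 1 := by
      have h4 : (n : ℝ) / p < (n / p : ℕ) + 1 := by
        rw [← Nat.floor_div_eq_div (K := ℝ)]
        exact Nat.lt_floor_add_one _
      have h5 : ((n / p : ℕ) : ℝ) ≤ n.factorial.factorization p := by exact_mod_cast h2
      linarith
    calc n * (Real.log p / p) = n / p * Real.log p := by ring
      _ ≤ (n.factorial.factorization p + 1) * Real.log p :=
        mul_le_mul_of_nonneg_right h3 (Real.log_natCast_nonneg p)
      _ = _ := by ring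
  have h2 := sum_le_sum h1
  rw [← mul_sum, sum_add_distrib, ← log_factorial_eq_sum_primes] at h2
  have h3 : Real.log n.factorial ≤ n * Real.log n := by
    rw [← Real.log_pow]
    refine Real.log_le_log (by exact_mod_cast n.factorial_pos) ?_
    exact_mod_cast Nat.factorial_le_pow n
  have h4 := sum_log_primes_Icc_le n
  have h5 : n * ∑ p ∈ (Icc 1 n).filter Nat.Prime, Real.log p / p ≤ n * (Real.log n + Real.log 4) := by
    linarith
  exact le_of_mul_le_mul_left h5 hn0

/-- Factor `n!` again, with exponents at most `n/(p - 1)`, against `n! ≥ (n/e)^n`. The excess `∑ log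
p / (p(p - 1))` converges. -/
lemma exists_log_le_sum_log_div_primes :
    ∃ C : ℝ, ∀ n : ℕ, 1 ≤ n → Real.log n - C ≤ ∑ p ∈ (Icc 1 n).filter Nat.Prime, Real.log p / p := by
  have hsum : Summable fun n : ℕ => 4 * (1 / (n : ℝ) ^ (3 / 2 : ℝ)) :=
    (Real.summable_one_div_nat_rpow.2 (by norm_num)).mul_left 4
  refine ⟨1 + ∑' n : ℕ, 4 * (1 / (n : ℝ) ^ (3 / 2 : ℝ)), fun n hn => ?_⟩
  have hn0 : (0 : ℝ) < n := by exact_mod_cast hn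
  have h1 : ∀ p ∈ (Icc 1 n).filter Nat.Prime, n.factorial.factorization p * Real.log p
      ≤ n * (Real.log p / p) + n * (4 * (1 / (p : ℝ) ^ (3 / 2 : ℝ))) := by
    intro p hp
    have hp' := (mem_filter.1 hp).2
    have hp2 : (2 : ℝ) ≤ p := by exact_mod_cast hp'.two_le
    have hp0 : (0 : ℝ) < p := by linarith
    have h2 : (n.factorial.factorization p : ℝ) ≤ n / (p - 1) := by
      have h3 : (n.factorial.factorization p : ℝ) ≤ (n / (p - 1) : ℕ) := by
        exact_mod_cast Nat.factorization_factorial_le_div_pred hp' n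
      refine h3.trans (Nat.cast_div_le.trans (le_of_eq ?_))
      rw [Nat.cast_sub hp'.one_le, Nat.cast_one]
    have hlog : Real.log p ≤ 2 * (p : ℝ) ^ (1 / 2 : ℝ) := by
      have := Real.log_le_rpow_div (x := p) (ε := 1 / 2) hp0.le (by norm_num)
      linarith
    have h4 : Real.log p / (p * (p - 1)) ≤ 4 * (1 / (p : ℝ) ^ (3 / 2 : ℝ)) := by
      have e : (p : ℝ) ^ (3 / 2 : ℝ) * (p : ℝ) ^ (1 / 2 : ℝ) = p * p := by
        rw [← Real.rpow_add hp0]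
        norm_num
        ring
      rw [mul_one_div, div_le_div_iff₀ (by nlinarith) (by positivity)]
      calc Real.log p * (p : ℝ) ^ (3 / 2 : ℝ) ≤ 2 * (p : ℝ) ^ (1 / 2 : ℝ) * (p : ℝ) ^ (3 / 2 : ℝ) := by
            gcongr
        _ = 2 * (p * p) := by rw [← e]; ring
        _ ≤ 4 * (p * (p - 1)) := by nlinarith
    calc n.factorial.factorization p * Real.log p ≤ n / (p - 1) * Real.log p :=
          mul_le_mul_of_nonneg_right h2 (Real.log_natCast_nonneg p)
      _ = n * (Real.log p / p) + n * (Real.log p / (p * (p - 1))) := by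
          have : (p : ℝ) - 1 ≠ 0 := by linarith
          field_simp
          ring
      _ ≤ _ := by gcongr
  have h2 := sum_le_sum h1
  rw [← log_factorial_eq_sum_primes, sum_add_distrib, ← mul_sum, ← mul_sum] at h2
  have h3 : ∑ p ∈ (Icc 1 n).filter Nat.Prime, 4 * (1 / (p : ℝ) ^ (3 / 2 : ℝ))
      ≤ ∑' n : ℕ, 4 * (1 / (n : ℝ) ^ (3 / 2 : ℝ)) :=
    hsum.sum_le_tsum _ fun p _ => by positivity
  have h4 : n * Real.log n - n ≤ Real.log n.factorial := by
    have h5 := Real.pow_div_factorial_le_exp (n : ℝ) hn0.le n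
    have hf : (0 : ℝ) < n.factorial := by exact_mod_cast n.factorial_pos
    have h6 := Real.log_le_log (by positivity) h5
    rw [Real.log_exp, Real.log_div (by positivity) hf.ne', Real.log_pow] at h6
    linarith
  have h5 : n * (Real.log n - (1 + ∑' n : ℕ, 4 * (1 / (n : ℝ) ^ (3 / 2 : ℝ))))
      ≤ n * ∑ p ∈ (Icc 1 n).filter Nat.Prime, Real.log p / p := by
    have := mul_le_mul_of_nonneg_left h3 hn0.le
    nlinarith
  exact le_of_mul_le_mul_left h5 hn0

/-- Mertens' first theorem. -/
lemma exists_abs_sum_log_div_primesUpTo_sub_log_le :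
    ∃ C : ℝ, 0 ≤ C ∧ ∀ x : ℝ, 1 ≤ x → |∑ p ∈ primesUpTo x, Real.log p / p - Real.log x| ≤ C := by
  obtain ⟨C, hC⟩ := exists_log_le_sum_log_div_primes
  refine ⟨max (C + Real.log 2) (Real.log 4), le_max_of_le_right (Real.log_nonneg (by norm_num)),
    fun x hx => ?_⟩
  have hn : 1 ≤ ⌊x⌋₊ := Nat.le_floor (by exact_mod_cast hx)
  have hn' : (1 : ℝ) ≤ ⌊x⌋₊ := by exact_mod_cast hn
  have h1 := hC _ hn
  have h2 := sum_log_div_primes_le hn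
  have h3 : Real.log ⌊x⌋₊ ≤ Real.log x :=
    Real.log_le_log (by linarith) (Nat.floor_le (by linarith))
  have h4 : Real.log x ≤ Real.log 2 + Real.log ⌊x⌋₊ := by
    rw [← Real.log_mul (by norm_num) (by linarith)]
    refine Real.log_le_log (by linarith) ?_
    linarith [Nat.lt_floor_add_one x]
  unfold primesUpTo
  rw [abs_le]
  have h5 := le_max_left (C + Real.log 2) (Real.log 4)
  have h6 := le_max_right (C + Real.log 2) (Real.log 4)
  constructor <;> linarith

/-! ### Assembling the chain of inequalities. -/

/-- `A` lies modulo `p` in an arithmetic progression of density at most `1 - ε`. -/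
def SievedByProg (ε : ℝ) (A : Finset ℤ) (p : ℕ) : Prop :=
  ∃ (S : Set (ZMod p)) (l : ℕ), IsArithProg S l ∧ (l : ℝ) ≤ (1 - ε) * p ∧ ∀ a ∈ A, (a : ZMod p) ∈ S

lemma SievedByProg.mono {ε : ℝ} {A B : Finset ℤ} {p : ℕ} (h : SievedByProg ε A p) (hB : B ⊆ A) :
    SievedByProg ε B p := by
  obtain ⟨S, l, h1, h2, h3⟩ := h
  exact ⟨S, l, h1, h2, fun a ha => h3 a (hB ha)⟩

lemma exists_large_coeffs {ε : ℝ} (hε : 0 < ε) {J : ℕ} (hJ : 2 ≤ ε ^ 2 * J) (A : Finset ℤ)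
    (hA : A.Nonempty) (P : Finset ℕ) (hP : ∀ p ∈ P, p.Prime) (hJP : ∀ p ∈ P, J ≤ p)
    (hS : ∀ p ∈ P, SievedByProg ε A p) :
    ∃ r : ℕ → ℤ, ∀ p ∈ P, ¬ (p : ℤ) ∣ r p ∧
      1 / (2 * J) * (A.card : ℝ) ≤ ‖∑ a ∈ A, ee (r p * a / p)‖ := by
  have : ∀ p ∈ P, ∃ r : ℤ, ¬ (p : ℤ) ∣ r ∧
      1 / (2 * J) * (A.card : ℝ) ≤ ‖∑ a ∈ A, ee (r * a / p)‖ := by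
    intro p hp
    obtain ⟨S, l, h1, h2, h3⟩ := hS p hp
    obtain ⟨r, hr, h⟩ := exists_large_coeff hε hJ (hP p hp) (hJP p hp) h1 h2 A hA h3
    exact ⟨r, hr, le_of_eq_of_le (by ring) h⟩
  choose! r hr using this
  exact ⟨r, hr⟩

/-- If `A` has large Fourier coefficients, many differences of `A` correlate with the frequencies. -/
lemma card_correlated_pairs_ge (A : Finset ℤ) (P : Finset ℕ) (w : ℕ → ℝ) (hw : ∀ p ∈ P, 0 ≤ w p)
    (hW : 0 < ∑ p ∈ P, w p) (r : ℕ → ℤ) {δ : ℝ} (hδ : 0 ≤ δ)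
    (hr : ∀ p ∈ P, δ * A.card ≤ ‖∑ a ∈ A, ee (r p * a / p)‖) :
    δ ^ 2 / 2 * A.card ^ 2 ≤ ((A ×ˢ A).filter fun x => δ ^ 2 / 2 * ∑ p ∈ P, w p
      ≤ ‖∑ p ∈ P, (w p : ℂ) * ee ((x.1 - x.2 : ℤ) * (r p / p))‖).card := by
  set W := ∑ p ∈ P, w p with hWdef
  set f : ℤ → ℂ := fun n => ∑ p ∈ P, (w p : ℂ) * ee (n * (r p / p)) with hf
  have hfW : ∀ n, ‖f n‖ ≤ W := by
    intro n
    refine (norm_sum_le _ _).trans (sum_le_sum fun p hp => ?_)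
    rw [norm_mul, norm_ee, mul_one, Complex.norm_real, Real.norm_of_nonneg (hw p hp)]
  have e : ((∑ p ∈ P, w p * ‖∑ a ∈ A, ee (r p * a / p)‖ ^ 2 : ℝ) : ℂ)
      = ∑ x ∈ A ×ˢ A, f (x.1 - x.2) := by
    rw [hf, sum_comm, Complex.ofReal_sum]
    refine sum_congr rfl fun p _ => ?_
    rw [Complex.ofReal_mul, sq_norm_sum_ee, ← mul_sum, sum_product]
    congr 1
    refine sum_congr rfl fun a _ => sum_congr rfl fun b _ => ?_
    congr 1
    push_cast
    ring
  -- The weighted second moment of the coefficients equals the sum of `f` over differences, so `f`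
  -- must often be large.
  have h1 : W * (δ * A.card) ^ 2 ≤ ∑ p ∈ P, w p * ‖∑ a ∈ A, ee (r p * a / p)‖ ^ 2 := by
    rw [hWdef, sum_mul]
    refine sum_le_sum fun p hp => mul_le_mul_of_nonneg_left ?_ (hw p hp)
    exact pow_le_pow_left₀ (by positivity) (hr p hp) 2
  have h2 : ∑ p ∈ P, w p * ‖∑ a ∈ A, ee (r p * a / p)‖ ^ 2 ≤ ∑ x ∈ A ×ˢ A, ‖f (x.1 - x.2)‖ := by
    rw [← Real.norm_of_nonneg (show 0 ≤ ∑ p ∈ P, w p * ‖∑ a ∈ A, ee (r p * a / p)‖ ^ 2 from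
      sum_nonneg fun p hp => mul_nonneg (hw p hp) (by positivity)), ← Complex.norm_real, e]
    exact norm_sum_le _ _
  have h3 : ∀ x ∈ A ×ˢ A, ‖f (x.1 - x.2)‖
      ≤ (if δ ^ 2 / 2 * W ≤ ‖f (x.1 - x.2)‖ then W else 0) + δ ^ 2 / 2 * W := by
    intro x _
    have h0 : 0 ≤ δ ^ 2 / 2 * W := by positivity
    split_ifs with h
    · linarith [hfW (x.1 - x.2)]
    · linarith
  have h4 := sum_le_sum h3
  rw [sum_add_distrib, ← sum_filter, sum_const, sum_const, card_product, nsmul_eq_mul,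
    nsmul_eq_mul] at h4
  push_cast at h4
  have h5 : W * (δ ^ 2 / 2 * A.card ^ 2) ≤ W *
      ((A ×ˢ A).filter fun x => δ ^ 2 / 2 * W ≤ ‖f (x.1 - x.2)‖).card := by
    nlinarith
  exact le_of_mul_le_mul_left h5 hW

/-- The chain of inequalities satisfied by a set sieved by progressions. -/
lemma exists_chain_of_sieved {N K M J m : ℕ} (hN : 1 ≤ N) (hm : 1 ≤ m) {ε τ δ γ : ℝ} (hε : 0 < ε)
    (hJ : 2 ≤ ε ^ 2 * J) (hδ : δ = 1 / (2 * J)) (hδ0 : 0 < δ) (hγ : γ = δ ^ 2 / 2) (hτ : 0 < τ)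
    (hτδ : 2 * τ ≤ δ) (hmτ : 16 / m ≤ τ ^ 2 / 2) (A : Finset ℤ) (hA : A ⊆ Icc 1 (N : ℤ))
    (hAne : A.Nonempty) (P₁ P₂ : Finset ℕ) (hP₁ : ∀ p ∈ P₁, p.Prime) (hP₂ : ∀ p ∈ P₂, p.Prime)
    (hJ₁ : ∀ p ∈ P₁, J ≤ p) (hJ₂ : ∀ p ∈ P₂, J ≤ p) (hS₁ : ∀ p ∈ P₁, SievedByProg ε A p)
    (hS₂ : ∀ p ∈ P₂, SievedByProg ε A p) (hKP : ∀ p ∈ P₁, K < p) (hPM : ∀ p ∈ P₁, p ≤ M)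
    (hM : M ^ (2 * K) ≤ N) (hW₁ : 0 < ∑ p ∈ P₁, Real.log p / p) (hW₂ : 0 < ∑ p ∈ P₂, Real.log p / p)
    (hPτ : ∀ p ∈ P₂, δ ≤ τ * p) :
    ∃ d a d' t : ℝ, 0 ≤ d ∧ 0 < a ∧ 0 ≤ d' ∧ 0 < t ∧
      d * (γ * ∑ p ∈ P₁, Real.log p / p) ^ (2 * K)
        ≤ 6 * N * (1 + Real.log N) * (K ^ K : ℕ) * (∑ p ∈ P₁, (Real.log p / p) ^ 2) ^ K ∧
      γ ^ 2 / 2 * A.card ^ 2 ≤ a ^ 2 ∧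
      d' * (1 / (4 * m) * γ ^ 2 / 2 * A.card) ≤ d ^ 2 ∧
      a ^ (m + 1) ≤ 2 * d' ^ m * t ∧
      (∑ p ∈ P₂, Real.log p / p) * t ≤ 12 * (τ / δ) * (t * Real.log N + ∑ p ∈ P₂, Real.log p) := by
  classical
  have hγ0 : 0 < γ := by rw [hγ]; positivity
  have hm0 : (0 : ℝ) < m := by exact_mod_cast hm
  have hA0 : (0 : ℝ) < A.card := by exact_mod_cast hAne.card_pos
  have hw : ∀ p : ℕ, 0 ≤ Real.log p / p := fun p =>
    div_nonneg (Real.log_natCast_nonneg p) (Nat.cast_nonneg _)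
  set w : ℕ → ℝ := fun p => Real.log p / p with hwdef
  obtain ⟨r, hr⟩ := exists_large_coeffs hε hJ A hAne P₁ hP₁ hJ₁ hS₁
  rw [← hδ] at hr
  set D : Finset ℤ := (Icc (-(N : ℤ)) N).filter fun n =>
    γ * ∑ p ∈ P₁, w p ≤ ‖∑ p ∈ P₁, (w p : ℂ) * ee (n * (r p / p))‖ with hD
  have hDcard := card_large_values_le hN P₁ hP₁ hKP hPM hM r (fun p hp => (hr p hp).1) w
    (L := γ * ∑ p ∈ P₁, w p) (by positivity) D (filter_subset _ _) fun n hn => (mem_filter.1 hn).2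
  have hpairs := card_correlated_pairs_ge A P₁ w (fun p _ => hw p) hW₁ r hδ0.le
    fun p hp => (hr p hp).2
  have hsub : ((A ×ˢ A).filter fun x => δ ^ 2 / 2 * ∑ p ∈ P₁, w p
      ≤ ‖∑ p ∈ P₁, (w p : ℂ) * ee ((x.1 - x.2 : ℤ) * (r p / p))‖)
      ⊆ (A ×ˢ A).filter fun x => x.1 - x.2 ∈ D := by
    intro x hx
    rw [mem_filter] at hx ⊢
    refine ⟨hx.1, mem_filter.2 ⟨?_, ?_⟩⟩
    · have h1 := mem_Icc.1 (hA (mem_product.1 hx.1).1)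
      have h2 := mem_Icc.1 (hA (mem_product.1 hx.1).2)
      rw [mem_Icc]
      constructor <;> linarith
    · rw [hγ]; exact hx.2
  obtain ⟨A', hA'A, D', hA'card, hD'card, hbad⟩ := exists_subset_popular_differences A D hγ0
    (κ := 1 / (4 * m)) (by positivity) hAne (by
      rw [hγ]
      refine hpairs.trans ?_
      exact_mod_cast card_le_card hsub)
  have hA'ne : A'.Nonempty := by
    rw [nonempty_iff_ne_empty]
    rintro rfl
    have : 0 < γ ^ 2 / 2 * (A.card : ℝ) ^ 2 := by positivity
    simp at hA'card
    linarith
  have hA'0 : (0 : ℝ) < A'.card := by exact_mod_cast hA'ne.card_pos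
  -- Being sieved passes to subsets, so `A'` has its own large coefficients; the frequencies `r`
  -- found for `A` are no longer needed.
  obtain ⟨ρ, hρ⟩ := exists_large_coeffs hε hJ A' hA'ne P₂ hP₂ hJ₂ fun p hp => (hS₂ p hp).mono hA'A
  rw [← hδ] at hρ
  obtain ⟨x, T, hTA, hTcard, hclose⟩ := exists_common_sample hm A' D' hA'ne hbad P₂ w
    (fun p _ => hw p) hW₂ (fun p a => ee (ρ p * a / p)) fun p a => (norm_ee _).le
  have hTne : T.Nonempty := by
    rw [nonempty_iff_ne_empty]
    rintro rfl
    have : 0 < (A'.card : ℝ) ^ (m + 1) := by positivity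
    simp at hTcard
    linarith
  have hfinal := larger_sieve_of_common_phases T (hTA.trans (hA'A.trans hA)) hTne P₂ hP₂ ρ
    (fun p hp => (hρ p hp).1) (fun p => (∑ i, ee (ρ p * x i / p)) / m)
    (fun p => (∑ a ∈ A', ee (ρ p * a / p)) / A'.card) hτ hτδ
    (fun p hp => by
      rw [norm_div, Complex.norm_natCast, le_div_iff₀ hA'0]
      exact (hρ p hp).2) hPτ hW₂ (by
    intro b hb
    refine le_trans (le_of_eq ?_) ((hclose b hb).trans (mul_le_mul_of_nonneg_right hmτ hW₂.le))
    refine sum_congr rfl fun p _ => ?_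
    have : ee (ρ p * b / p) * ((∑ i, ee (ρ p * x i / p)) / m)
        = (∑ i, ee (ρ p * ((x i + b : ℤ) : ℝ) / p)) / m := by
      rw [mul_div_assoc', mul_sum]
      congr 1
      refine sum_congr rfl fun i _ => ?_
      rw [← ee_add]
      congr 1
      push_cast
      ring
    rw [this])
  exact ⟨D.card, A'.card, D'.card, T.card, Nat.cast_nonneg _, hA'0, Nat.cast_nonneg _,
    by exact_mod_cast hTne.card_pos, hDcard, hA'card, hD'card, hTcard, hfinal⟩

lemma sum_log_div_filter_ge {C : ℝ}
    (hC : ∀ x : ℝ, 1 ≤ x → |∑ p ∈ primesUpTo x, Real.log p / p - Real.log x| ≤ C) {y z : ℝ}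
    (hy : 1 ≤ y) (hz : 1 ≤ z) (P : Finset ℕ) :
    Real.log z - Real.log y - 2 * C - ∑ p ∈ primesUpTo z \ P, Real.log p / p
      ≤ ∑ p ∈ (primesUpTo z).filter (fun p : ℕ => y < p ∧ p ∈ P), Real.log p / p := by
  have hw : ∀ p : ℕ, 0 ≤ Real.log p / p := fun p =>
    div_nonneg (Real.log_natCast_nonneg p) (Nat.cast_nonneg _)
  have hsub : primesUpTo z ⊆ (primesUpTo z).filter (fun p : ℕ => y < p ∧ p ∈ P)
      ∪ (primesUpTo y ∪ primesUpTo z \ P) := by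
    intro p hp
    by_cases h1 : p ∈ P
    · by_cases h2 : y < p
      · exact mem_union_left _ (mem_filter.2 ⟨hp, h2, h1⟩)
      · refine mem_union_right _ (mem_union_left _ ?_)
        have hp' := mem_filter.1 hp
        exact mem_filter.2 ⟨mem_Icc.2 ⟨(mem_Icc.1 hp'.1).1, Nat.le_floor (not_lt.1 h2)⟩, hp'.2⟩
    · exact mem_union_right _ (mem_union_right _ (mem_sdiff.2 ⟨hp, h1⟩))
  have h1 : ∀ s t : Finset ℕ, ∑ p ∈ s ∪ t, Real.log p / p
      ≤ ∑ p ∈ s, Real.log p / (p : ℝ) + ∑ p ∈ t, Real.log p / (p : ℝ) := by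
    intro s t
    rw [← sum_union_inter]
    linarith [sum_nonneg fun p (_ : p ∈ s ∩ t) => hw p]
  have h2 := sum_le_sum_of_subset_of_nonneg hsub fun p _ _ => hw p
  have h3 := h1 ((primesUpTo z).filter (fun p : ℕ => y < p ∧ p ∈ P)) (primesUpTo y ∪ primesUpTo z \ P)
  have h4 := h1 (primesUpTo y) (primesUpTo z \ P)
  have h5 := abs_le.1 (hC y hy)
  have h6 := abs_le.1 (hC z hz)
  linarith

/-! ### Exponents, choice of parameters and conclusion. -/

/-- The exponents in the chain of inequalities force the final set to be large. -/
lemma rpow_le_of_chain {X ℓ η γ α W S Y d a d' t : ℝ} {K m : ℕ} (hm : 1 ≤ m) (hX : 1 ≤ X)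
    (hℓ : 0 ≤ ℓ) (hη : η = 1 / (80 * m)) (hγ : 0 < γ) (hW : 1 ≤ W) (hY0 : 0 < Y)
    (hY : Y ^ K = X ^ ((1 - η) / 2)) (hS : S ≤ W * (ℓ / Y)) (hS0 : 0 ≤ S)
    (hlog : 6 * (1 + ℓ) * (K * ℓ / γ ^ 2) ^ K ≤ X ^ (3 * η / 2)) (hconst : 8 * m / γ ^ 2 ≤ X ^ η)
    (h2 : 2 ≤ X ^ (1 / 8 : ℝ)) (hα : X ^ (1 / 2 - η) ≤ α) (hd0 : 0 ≤ d) (ha0 : 0 < a)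
    (hd'0 : 0 ≤ d') (ht0 : 0 < t)
    (hd : d * (γ * W) ^ (2 * K) ≤ 6 * X * (1 + ℓ) * (K ^ K : ℕ) * S ^ K)
    (ha : γ ^ 2 / 2 * α ^ 2 ≤ a ^ 2) (hd' : d' * (1 / (4 * m) * γ ^ 2 / 2 * α) ≤ d ^ 2)
    (ht : a ^ (m + 1) ≤ 2 * d' ^ m * t) : X ^ (1 / 4 : ℝ) ≤ t := by
  have hX0 : 0 < X := by linarith
  have hm0 : (0 : ℝ) < m := by exact_mod_cast hm
  have hm1 : (1 : ℝ) ≤ m := by exact_mod_cast hm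
  have hη0 : 0 < η := by rw [hη]; positivity
  -- `S^K` saves `Y^K = X^((1-η)/2)` over the trivial `W^(2K)`; logarithms and constants cost
  -- `X^(3η/2)`.
  have hdle : d ≤ X ^ (1 / 2 + 2 * η) := by
    have h3 : S ^ K ≤ W ^ K * ℓ ^ K / Y ^ K := by
      refine (pow_le_pow_left₀ hS0 hS K).trans (le_of_eq ?_)
      rw [mul_pow, div_pow]; ring
    have h4 : d * (γ ^ 2) ^ K * W ^ K * W ^ K ≤ W ^ K * W ^ K *
        (6 * X * (1 + ℓ) * (K : ℝ) ^ K * (ℓ ^ K / Y ^ K)) := by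
      calc d * (γ ^ 2) ^ K * W ^ K * W ^ K = d * (γ * W) ^ (2 * K) := by
            rw [mul_pow, pow_mul γ, two_mul K, pow_add W]; ring
        _ ≤ 6 * X * (1 + ℓ) * (K ^ K : ℕ) * (W ^ K * ℓ ^ K / Y ^ K) :=
            hd.trans (by gcongr)
        _ = W ^ K * (6 * X * (1 + ℓ) * (K : ℝ) ^ K * (ℓ ^ K / Y ^ K)) := by push_cast; ring
        _ ≤ W ^ K * W ^ K * (6 * X * (1 + ℓ) * (K : ℝ) ^ K * (ℓ ^ K / Y ^ K)) := by
            have h5 : 1 ≤ W ^ K := one_le_pow₀ hW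
            have : W ^ K ≤ W ^ K * W ^ K := le_mul_of_one_le_right (by linarith) h5
            exact mul_le_mul_of_nonneg_right this (by positivity)
    have h5 : d * (γ ^ 2) ^ K ≤ 6 * X * (1 + ℓ) * (K : ℝ) ^ K * (ℓ ^ K / Y ^ K) := by
      have hWK : 0 < W ^ K * W ^ K := by positivity
      refine le_of_mul_le_mul_left ?_ hWK
      refine le_trans (le_of_eq ?_) h4
      ring
    have h6 : d ≤ (6 * (1 + ℓ) * (K * ℓ / γ ^ 2) ^ K) * (X / X ^ ((1 - η) / 2)) := by
      have hγK : 0 < (γ ^ 2) ^ K := by positivity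
      rw [← hY, ← mul_le_mul_iff_left₀ hγK]
      refine h5.trans (le_of_eq ?_)
      rw [div_pow, mul_pow]
      field_simp
    have h7 : X / X ^ ((1 - η) / 2) = X ^ (1 - (1 - η) / 2) := by
      rw [Real.rpow_sub hX0, Real.rpow_one]
    calc d ≤ _ := h6
      _ ≤ X ^ (3 * η / 2) * X ^ (1 - (1 - η) / 2) := by rw [h7]; gcongr
      _ = X ^ (1 / 2 + 2 * η) := by rw [← Real.rpow_add hX0]; congr 1; ring
  have hd'le : d' ≤ X ^ (1 / 2 + 6 * η) := by
    have hpos : 0 < X ^ (1 / 2 - η) := by positivity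
    have h3 : d' * (γ ^ 2 / (8 * m) * X ^ (1 / 2 - η)) ≤ X ^ (1 + 4 * η) := by
      calc d' * (γ ^ 2 / (8 * m) * X ^ (1 / 2 - η)) ≤ d' * (1 / (4 * m) * γ ^ 2 / 2 * α) := by
            refine mul_le_mul_of_nonneg_left ?_ hd'0
            have : 1 / (4 * m) * γ ^ 2 / 2 = γ ^ 2 / (8 * m) := by field_simp; norm_num
            rw [this]
            gcongr
        _ ≤ d ^ 2 := hd'
        _ ≤ (X ^ (1 / 2 + 2 * η)) ^ 2 := by gcongr
        _ = X ^ (1 + 4 * η) := by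
            rw [← Real.rpow_natCast, ← Real.rpow_mul hX0.le]; congr 1; push_cast; ring
    have h4 : d' = d' * (γ ^ 2 / (8 * m) * X ^ (1 / 2 - η)) * (8 * m / γ ^ 2) * X ^ (-(1 / 2 - η)) := by
      rw [Real.rpow_neg hX0.le]
      field_simp
    rw [h4]
    calc _ ≤ X ^ (1 + 4 * η) * X ^ η * X ^ (-(1 / 2 - η)) := by gcongr
      _ = X ^ (1 / 2 + 6 * η) := by
        rw [← Real.rpow_add hX0, ← Real.rpow_add hX0]; congr 1; ring
  have hale : X ^ (1 / 2 - 2 * η) ≤ a := by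
    have h3 : (X ^ (1 / 2 - 2 * η)) ^ 2 ≤ a ^ 2 := by
      refine le_trans ?_ ha
      have h4 : 2 / γ ^ 2 ≤ X ^ (2 * η) := by
        calc 2 / γ ^ 2 ≤ 8 * m / γ ^ 2 := by gcongr; linarith
          _ ≤ X ^ η := hconst
          _ ≤ X ^ (2 * η) := Real.rpow_le_rpow_of_exponent_le hX (by linarith)
      have h5 : 1 ≤ γ ^ 2 / 2 * X ^ (2 * η) := by
        rw [div_le_iff₀ (by positivity)] at h4
        linarith
      have h6 : (X ^ (1 / 2 - 2 * η)) ^ 2 * X ^ (2 * η) = (X ^ (1 / 2 - η)) ^ 2 := by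
        rw [← Real.rpow_natCast, ← Real.rpow_natCast, ← Real.rpow_mul hX0.le,
          ← Real.rpow_mul hX0.le, ← Real.rpow_add hX0]
        congr 1
        push_cast
        ring
      calc (X ^ (1 / 2 - 2 * η)) ^ 2 ≤ (X ^ (1 / 2 - 2 * η)) ^ 2 * (γ ^ 2 / 2 * X ^ (2 * η)) :=
            le_mul_of_one_le_right (by positivity) h5
        _ = γ ^ 2 / 2 * (X ^ (1 / 2 - η)) ^ 2 := by rw [← h6]; ring
        _ ≤ γ ^ 2 / 2 * α ^ 2 := by gcongr
    exact le_of_sq_le_sq h3 ha0.le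
  have hfin : X ^ ((1 / 2 - 2 * η) * (m + 1)) ≤ 2 * X ^ ((1 / 2 + 6 * η) * m) * t := by
    calc X ^ ((1 / 2 - 2 * η) * (m + 1)) = (X ^ (1 / 2 - 2 * η)) ^ (m + 1) := by
          rw [← Real.rpow_natCast, ← Real.rpow_mul hX0.le]; push_cast; rfl
      _ ≤ a ^ (m + 1) := by gcongr
      _ ≤ 2 * d' ^ m * t := ht
      _ ≤ 2 * (X ^ (1 / 2 + 6 * η)) ^ m * t := by gcongr
      _ = _ := by rw [← Real.rpow_natCast (X ^ (1 / 2 + 6 * η)), ← Real.rpow_mul hX0.le]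
  -- The exponents differ by `1/2 - 2η - 8ηm`. As `ηm = 1/80`, this is at least `1/2 - 1/40 - 1/10 =
  -- 3/8`.
  have h38 : X ^ (3 / 8 : ℝ) * X ^ ((1 / 2 + 6 * η) * m) ≤ X ^ ((1 / 2 - 2 * η) * (m + 1)) := by
    rw [← Real.rpow_add hX0]
    refine Real.rpow_le_rpow_of_exponent_le hX ?_
    have e : η * m = 1 / 80 := by rw [hη]; field_simp
    have e2 : η ≤ 1 / 80 := by rw [← e]; nlinarith
    nlinarith
  have h4 : X ^ (3 / 8 : ℝ) ≤ 2 * t := by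
    have hp : 0 < X ^ ((1 / 2 + 6 * η) * m) := by positivity
    refine le_of_mul_le_mul_right ((h38.trans hfin).trans (le_of_eq ?_)) hp
    ring
  have h5 : X ^ (3 / 8 : ℝ) = X ^ (1 / 8 : ℝ) * X ^ (1 / 4 : ℝ) := by
    rw [← Real.rpow_add hX0]; norm_num
  have h6 : 2 * X ^ (1 / 4 : ℝ) ≤ 2 * t := by
    calc 2 * X ^ (1 / 4 : ℝ) ≤ X ^ (1 / 8 : ℝ) * X ^ (1 / 4 : ℝ) := by gcongr
      _ = X ^ (3 / 8 : ℝ) := h5.symm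
      _ ≤ 2 * t := h4
  linarith

open Filter in
lemma eventually_log_pow_le_rpow (K : ℕ) (B : ℝ) {η : ℝ} (hη : 0 < η) :
    ∀ᶠ N : ℕ in atTop, 6 * (1 + Real.log N) * (B * Real.log N) ^ K ≤ (N : ℝ) ^ η := by
  have h0 := (isLittleO_log_rpow_rpow_atTop ((K : ℝ) + 1) hη).bound
    (c := 1 / (12 * (|B| ^ K + 1))) (by positivity)
  have h1 : ∀ᶠ x : ℝ in atTop, 6 * (1 + Real.log x) * (B * Real.log x) ^ K ≤ x ^ η := by
    filter_upwards [h0, Real.tendsto_log_atTop.eventually_ge_atTop 1, eventually_ge_atTop 1]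
      with x hx hl hx1
    have hl0 : 0 < Real.log x := by linarith
    rw [Real.norm_of_nonneg (by positivity), Real.norm_of_nonneg (by positivity),
      Real.rpow_add hl0, Real.rpow_one, Real.rpow_natCast, one_div, inv_mul_eq_div,
      le_div_iff₀ (by positivity)] at hx
    have h2 : (B * Real.log x) ^ K ≤ (|B| ^ K + 1) * Real.log x ^ K := by
      calc (B * Real.log x) ^ K ≤ (|B| * Real.log x) ^ K := by
            refine (le_abs_self _).trans ?_
            rw [abs_pow, abs_mul, abs_of_pos hl0]
        _ = |B| ^ K * Real.log x ^ K := mul_pow _ _ _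
        _ ≤ _ := by gcongr; linarith
    calc 6 * (1 + Real.log x) * (B * Real.log x) ^ K
        ≤ 6 * (1 + Real.log x) * ((|B| ^ K + 1) * Real.log x ^ K) := by gcongr
      _ ≤ 6 * (2 * Real.log x) * ((|B| ^ K + 1) * Real.log x ^ K) := by gcongr; linarith
      _ = Real.log x ^ K * Real.log x * (12 * (|B| ^ K + 1)) := by ring
      _ ≤ x ^ η := hx
  exact tendsto_natCast_atTop_atTop.eventually h1

open Filter in
set_option maxHeartbeats 1000000 in
/-- The bound for sieved sets of integers, in contrapositive form and for large `N`. -/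
lemma exists_saving {k : ℕ} (hk : 1 ≤ k) {ε : ℝ} (hε : 0 < ε) :
    ∃ c₀ : ℝ, 0 < c₀ ∧ c₀ ≤ 1 / 2 ∧ ∀ᶠ N : ℕ in atTop, ∀ c ≤ c₀, ∀ (A : Finset ℤ) (P : Finset ℕ),
      A ⊆ Icc 1 (N : ℤ) →
      (∑ p ∈ primesUpTo ((N : ℝ) ^ (1 / (2 * (k : ℝ)))) \ P, Real.log (p : ℝ) / (p : ℝ))
        ≤ c * Real.log N →
      (∀ p ∈ P, SievedByProg ε A p) → (A.card : ℝ) < (N : ℝ) ^ (1 / 2 - c) := by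
  obtain ⟨C, hC0, hC⟩ := exists_abs_sum_log_div_primesUpTo_sub_log_le
  -- Doubling `k` gives `K ≥ 2`, so the primes used are at most `N^(1/(2K)) ≤ N^(1/4)`, below the
  -- lower bound for `|T|`.
  set K : ℕ := 2 * k with hK
  have hK2 : (2 : ℝ) ≤ K := by rw [hK]; push_cast; have : (1 : ℝ) ≤ k := by exact_mod_cast hk
                               linarith
  obtain ⟨J, hJ0, hJ⟩ : ∃ J : ℕ, 1 ≤ J ∧ 2 ≤ ε ^ 2 * J := by
    refine ⟨⌈2 / ε ^ 2⌉₊, Nat.one_le_ceil_iff.2 (by positivity), ?_⟩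
    have := Nat.le_ceil (2 / ε ^ 2)
    rw [div_le_iff₀ (by positivity)] at this
    linarith
  have hJ0' : (0 : ℝ) < J := by exact_mod_cast hJ0
  set δ : ℝ := 1 / (2 * J) with hδ
  have hδ0 : 0 < δ := by positivity
  set γ : ℝ := δ ^ 2 / 2 with hγ
  have hγ0 : 0 < γ := by positivity
  -- The larger sieve will compare `log N / (4K)` with `24 (τ/δ) log N`; this choice makes the
  -- latter smaller.
  set τ : ℝ := δ / (100 * K) with hτ
  have hτ0 : 0 < τ := by positivity
  obtain ⟨m, hm, hmτ⟩ : ∃ m : ℕ, 1 ≤ m ∧ 16 / (m : ℝ) ≤ τ ^ 2 / 2 := by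
    refine ⟨⌈32 / τ ^ 2⌉₊, Nat.one_le_ceil_iff.2 (by positivity), ?_⟩
    have := Nat.le_ceil (32 / τ ^ 2)
    have h0 : (0 : ℝ) < ⌈32 / τ ^ 2⌉₊ := lt_of_lt_of_le (by positivity) this
    rw [div_le_iff₀ (by positivity)] at this
    rw [div_le_iff₀ h0]
    linarith
  have hm1 : (1 : ℝ) ≤ m := by exact_mod_cast hm
  set η : ℝ := 1 / (80 * m) with hη
  have hη0 : 0 < η := by positivity
  have hη1 : η ≤ 1 / 80 := by
    rw [hη]
    exact one_div_le_one_div_of_le (by norm_num) (by linarith)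
  set q : ℝ := max J (100 * K) with hq
  have hqJ : (J : ℝ) ≤ q := le_max_left _ _
  have hqK : 100 * (K : ℝ) ≤ q := le_max_right _ _
  have hq1 : 1 ≤ q := by linarith
  clear_value K δ γ τ η q
  have hc₀1 : η / (4 * K) ≤ 1 / (8 * K) := by
    rw [div_le_div_iff₀ (by positivity) (by positivity)]
    nlinarith
  have hc₀2 : η / (4 * K) ≤ η := div_le_self hη0.le (by linarith)
  -- The interval `(Y, Z]` carries weight about `η log N / (2K)`; the missing primes may remove at
  -- most half of it.
  refine ⟨η / (4 * K), by positivity, by linarith, ?_⟩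
  have hlogt : Tendsto (fun N : ℕ => Real.log N) atTop atTop :=
    Real.tendsto_log_atTop.comp tendsto_natCast_atTop_atTop
  have hrpow : ∀ s : ℝ, 0 < s → Tendsto (fun N : ℕ => (N : ℝ) ^ s) atTop atTop := fun s hs =>
    (tendsto_rpow_atTop hs).comp tendsto_natCast_atTop_atTop
  filter_upwards [eventually_log_pow_le_rpow K (K / γ ^ 2) (show 0 < 3 * η / 2 by positivity),
    (hrpow η hη0).eventually_ge_atTop (8 * m / γ ^ 2),
    (hrpow (1 / 8) (by norm_num)).eventually_ge_atTop 2,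
    hlogt.eventually_ge_atTop 2, hlogt.eventually_ge_atTop ((2 * C + 1) * (4 * K / η)),
    hlogt.eventually_ge_atTop ((Real.log q + 2 * C) * (8 * K)),
    (hrpow ((1 - η) / (2 * K)) (by apply div_pos <;> linarith)).eventually_ge_atTop q,
    eventually_ge_atTop 1] with N E1 E2 E3 E4 E5 E6 E7 hN
  intro c hc A P hA hmiss hS
  by_contra! hcard
  have hX : (1 : ℝ) ≤ N := by exact_mod_cast hN
  have hX0 : (0 : ℝ) < N := by linarith
  set ℓ := Real.log N with hℓ
  set Z : ℝ := (N : ℝ) ^ (1 / (2 * (K : ℝ))) with hZ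
  set Y : ℝ := (N : ℝ) ^ ((1 - η) / (2 * (K : ℝ))) with hY
  have hZ1 : 1 ≤ Z := Real.one_le_rpow hX (by positivity)
  have hY1 : 1 ≤ Y := by linarith
  have hlogZ : Real.log Z = ℓ / (2 * K) := by rw [hZ, Real.log_rpow hX0]; ring
  have hlogY : Real.log Y = (1 - η) / (2 * K) * ℓ := by rw [hY, Real.log_rpow hX0]
  have hAne : A.Nonempty := by
    rw [← card_pos]
    have : (0 : ℝ) < A.card := lt_of_lt_of_le (by positivity) hcard
    exact_mod_cast this
  have hZk : Z ≤ (N : ℝ) ^ (1 / (2 * (k : ℝ))) := by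
    rw [hZ]
    refine Real.rpow_le_rpow_of_exponent_le hX ?_
    have hk0 : (0 : ℝ) < k := by exact_mod_cast hk
    refine one_div_le_one_div_of_le (by positivity) ?_
    rw [hK]; push_cast; linarith
  have hmissZ : ∑ p ∈ primesUpTo Z \ P, Real.log p / (p : ℝ) ≤ η / (4 * K) * ℓ := by
    refine (sum_le_sum_of_subset_of_nonneg (sdiff_subset_sdiff ?_ le_rfl) fun p _ _ =>
      div_nonneg (Real.log_natCast_nonneg p) (Nat.cast_nonneg _)).trans
      (hmiss.trans (by gcongr))
    exact filter_subset_filter _ (Icc_subset_Icc_right (Nat.floor_le_floor hZk))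
  -- `P₁` stays close to `Z`, which makes the moment bound nearly sharp. `P₂` reaches down to the
  -- constant `q`, so its weight is a fixed multiple of `log N`, as the larger sieve requires.
  set P₁ := (primesUpTo Z).filter (fun p : ℕ => Y < p ∧ p ∈ P) with hP₁
  set P₂ := (primesUpTo Z).filter (fun p : ℕ => q < p ∧ p ∈ P) with hP₂
  have hW₁ : 1 ≤ ∑ p ∈ P₁, Real.log p / (p : ℝ) := by
    have h := sum_log_div_filter_ge hC hY1 hZ1 P
    rw [hlogZ, hlogY] at h
    have h1 : (2 * C + 1) ≤ η / (4 * K) * ℓ := by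
      have : (2 * C + 1) = η / (4 * K) * ((2 * C + 1) * (4 * K / η)) := by field_simp
      rw [this]; gcongr
    have h2 : ℓ / (2 * K) - (1 - η) / (2 * K) * ℓ = 2 * (η / (4 * K) * ℓ) := by ring
    linarith
  have hW₂ : ℓ / (4 * K) ≤ ∑ p ∈ P₂, Real.log p / (p : ℝ) := by
    have h := sum_log_div_filter_ge hC hq1 hZ1 P
    rw [hlogZ] at h
    have h1 : Real.log q + 2 * C ≤ ℓ / (8 * K) := by
      rw [le_div_iff₀ (by positivity)]; exact E6
    have h2 : η / (4 * K) * ℓ ≤ ℓ / (8 * K) := by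
      calc η / (4 * K) * ℓ ≤ 1 / (8 * K) * ℓ := by gcongr
        _ = _ := by ring
    have h3 : ℓ / (2 * K) = ℓ / (8 * K) + ℓ / (8 * K) + ℓ / (4 * K) := by ring
    linarith
  have hmem : ∀ p ∈ primesUpTo Z, p.Prime ∧ (p : ℝ) ≤ Z ∧ p ≤ ⌊Z⌋₊ := by
    intro p hp
    have h := mem_filter.1 hp
    have h2 := (mem_Icc.1 h.1).2
    exact ⟨h.2, (Nat.le_floor_iff (by linarith)).1 h2, h2⟩
  have h₁ : ∀ p ∈ P₁, p ∈ primesUpTo Z ∧ Y < p ∧ p ∈ P := fun p hp => mem_filter.1 hp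
  have h₂ : ∀ p ∈ P₂, p ∈ primesUpTo Z ∧ q < p ∧ p ∈ P := fun p hp => mem_filter.1 hp
  have hMN : ⌊Z⌋₊ ^ (2 * K) ≤ N := by
    have h1 : (⌊Z⌋₊ : ℝ) ^ (2 * K) ≤ N := by
      calc (⌊Z⌋₊ : ℝ) ^ (2 * K) ≤ Z ^ (2 * K) := by gcongr; exact Nat.floor_le (by linarith)
        _ = N := by
          rw [hZ, ← Real.rpow_natCast, ← Real.rpow_mul hX0.le]
          push_cast
          rw [one_div_mul_cancel (by positivity), Real.rpow_one]
    exact_mod_cast h1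
  have hτδ : τ / δ = 1 / (100 * K) := by rw [hτ]; field_simp
  obtain ⟨d, a, d', t, hd0, ha0, hd'0, ht0, hd, ha, hd', ht, hlast⟩ := exists_chain_of_sieved
    (K := K) (M := ⌊Z⌋₊) hN hm hε hJ hδ hδ0 hγ hτ0
    (by rw [hτ, mul_div_assoc', div_le_iff₀ (by positivity)]; nlinarith) hmτ A hA hAne P₁ P₂
    (fun p hp => (hmem p (h₁ p hp).1).1) (fun p hp => (hmem p (h₂ p hp).1).1)
    (fun p hp => by have := (h₁ p hp).2.1; exact_mod_cast (by linarith : (J : ℝ) ≤ p))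
    (fun p hp => by have := (h₂ p hp).2.1; exact_mod_cast (by linarith : (J : ℝ) ≤ p))
    (fun p hp => hS p (h₁ p hp).2.2) (fun p hp => hS p (h₂ p hp).2.2)
    (fun p hp => by have := (h₁ p hp).2.1; exact_mod_cast (by linarith : (K : ℝ) < p))
    (fun p hp => (hmem p (h₁ p hp).1).2.2) hMN (by linarith) (lt_of_lt_of_le (by positivity) hW₂)
    (fun p hp => by
      have := (h₂ p hp).2.1
      rw [hτ, div_mul_eq_mul_div, le_div_iff₀ (by positivity)]
      gcongr
      linarith)
  have hS : ∑ p ∈ P₁, (Real.log p / (p : ℝ)) ^ 2 ≤ (∑ p ∈ P₁, Real.log p / (p : ℝ)) * (ℓ / Y) := by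
    rw [sum_mul]
    refine sum_le_sum fun p hp => ?_
    have hp' := hmem p (h₁ p hp).1
    have hp0 : (0 : ℝ) < p := by exact_mod_cast hp'.1.pos
    rw [sq]
    refine mul_le_mul_of_nonneg_left ?_
      (div_nonneg (Real.log_natCast_nonneg p) (Nat.cast_nonneg _))
    have hZN : Z ≤ N := by
      calc Z ≤ (N : ℝ) ^ (1 : ℝ) := by
            refine Real.rpow_le_rpow_of_exponent_le hX ?_
            rw [div_le_one (by positivity)]; linarith
        _ = N := Real.rpow_one _
    exact div_le_div₀ (by linarith) (Real.log_le_log hp0 (hp'.2.1.trans hZN)) (by linarith)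
      (h₁ p hp).2.1.le
  have htX := rpow_le_of_chain (Y := Y) hm hX (by linarith : 0 ≤ ℓ) hη hγ0 hW₁ (by linarith) (by
      rw [hY, ← Real.rpow_natCast, ← Real.rpow_mul hX0.le]
      congr 1
      field_simp) hS (sum_nonneg fun _ _ => by positivity)
    (by rw [mul_div_right_comm]; exact E1) E2 E3 ((Real.rpow_le_rpow_of_exponent_le hX (by linarith)).trans hcard)
    hd0 ha0 hd'0 ht0 hd ha hd' ht
  have hZt : Z ≤ t := by
    refine (Real.rpow_le_rpow_of_exponent_le hX ?_).trans htX
    exact one_div_le_one_div_of_le (by norm_num) (by linarith)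
  have hθ : ∑ p ∈ P₂, Real.log p ≤ 2 * t := by
    have h1 : ∑ p ∈ P₂, Real.log p ≤ Real.log 4 * ⌊Z⌋₊ :=
      (sum_le_sum_of_subset_of_nonneg (filter_subset _ _) fun p _ _ =>
        Real.log_natCast_nonneg p).trans (sum_log_primes_Icc_le _)
    have h2 : Real.log 4 ≤ 2 := by
      rw [show (4 : ℝ) = 2 ^ 2 by norm_num, Real.log_pow]
      have := Real.log_two_lt_d9
      push_cast
      linarith
    have h3 : (⌊Z⌋₊ : ℝ) ≤ Z := Nat.floor_le (by linarith)
    calc _ ≤ _ := h1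
      _ ≤ 2 * Z := by gcongr
      _ ≤ 2 * t := by linarith
  rw [hτδ] at hlast
  have h3 : ℓ / (4 * K) * t ≤ 12 * (1 / (100 * K)) * (t * ℓ + 2 * t) :=
    (mul_le_mul_of_nonneg_right hW₂ ht0.le).trans (hlast.trans (by gcongr))
  have h4 : ℓ / (4 * K) * t ≤ 24 / (100 * K) * (t * ℓ) := by
    refine h3.trans ?_
    calc 12 * (1 / (100 * (K : ℝ))) * (t * ℓ + 2 * t) ≤ 12 * (1 / (100 * K)) * (t * ℓ + ℓ * t) := by
          gcongr
      _ = _ := by ring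
  -- After cross-multiplying, the contradiction is `100 ≤ 96`.
  rw [div_mul_eq_mul_div, div_mul_eq_mul_div, div_le_div_iff₀ (by positivity) (by positivity)] at h4
  have hpos : 0 < t * ℓ * K := by positivity
  have h5 : ℓ * t * (100 * K) = 100 * (t * ℓ * K) := by ring
  have h6 : 24 * (t * ℓ) * (4 * K) = 96 * (t * ℓ * K) := by ring
  linarith

theorem theorem5p2 (k : ℕ) (hk : 1 ≤ k) (ε : ℝ) (hε : 0 < ε) :
    ∃ c₀ : ℝ, 0 < c₀ ∧ ∀ c : ℝ, 0 < c → c ≤ c₀ →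
      ∃ C : ℝ, 0 < C ∧
        ∀ (N : ℕ) (A P : Finset ℕ), 1 ≤ N → A ⊆ Finset.Icc 1 N →
          P ⊆ primesUpTo ((N : ℝ) ^ (1 / (2 * (k : ℝ)))) →
          (∑ p ∈ primesUpTo ((N : ℝ) ^ (1 / (2 * (k : ℝ)))) \ P, Real.log (p : ℝ) / (p : ℝ))
            < c * Real.log (N : ℝ) →
          (∀ p ∈ P, ∃ (S : Set (ZMod p)) (l : ℕ),
            IsArithProg S l ∧ (l : ℝ) ≤ (1 - ε) * (p : ℝ) ∧ ∀ a ∈ A, (a : ZMod p) ∈ S) →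
          (A.card : ℝ) ≤ C * (N : ℝ) ^ (1 / 2 - c) := by
  obtain ⟨c₀, hc₀, hc₀2, hev⟩ := exists_saving hk hε
  refine ⟨c₀, hc₀, fun c _ hc => ?_⟩
  obtain ⟨N₀, hN₀⟩ := Filter.eventually_atTop.1 hev
  -- For `N ≤ N₀` the trivial bound `|A| ≤ N₀` is enough, since `c ≤ 1/2` makes the power of `N` at
  -- least 1.
  refine ⟨N₀ + 1, by positivity, fun N A P hN hA _ hmiss hS => ?_⟩
  have hX : (1 : ℝ) ≤ N := by exact_mod_cast hN
  have hpow : 1 ≤ (N : ℝ) ^ (1 / 2 - c) := Real.one_le_rpow hX (by linarith)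
  have hN₀' : (0 : ℝ) ≤ N₀ := Nat.cast_nonneg _
  rcases le_total N₀ N with h | h
  · have hlt := hN₀ N h c hc (A.map Nat.castEmbedding) P (by
      intro a ha
      obtain ⟨b, hb, rfl⟩ := mem_map.1 ha
      have := mem_Icc.1 (hA hb)
      rw [mem_Icc, Nat.castEmbedding_apply]
      exact ⟨by exact_mod_cast this.1, by exact_mod_cast this.2⟩) hmiss.le (by
      intro p hp
      obtain ⟨S, l, h1, h2, h3⟩ := hS p hp
      refine ⟨S, l, h1, h2, fun a ha => ?_⟩
      obtain ⟨b, hb, rfl⟩ := mem_map.1 ha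
      simpa using h3 b hb)
    rw [card_map] at hlt
    nlinarith
  · have h1 : A.card ≤ N := (card_le_card hA).trans (by simp)
    have h2 : (A.card : ℝ) ≤ N₀ := by exact_mod_cast h1.trans h
    nlinarith
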